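/- **Conventions.** An MV-algebra is $(A,\oplus,{}^*,0)$ with $(A,\oplus,0)$ a commutative monoid, $x^{**}=x$, $x\oplus 0^*=0^*$ and $(x^*\oplus y)^*\oplus y=(y^*\oplus x)^*\oplus x$; put $1=0^*$, $x\odot y=(x^*\oplus y^*)^*$, $x\ominus y=x\odot y^*$, $d(x,y)=(x\ominus y)\oplus(y\ominus x)$, and $x\le y$ iff $x^*\oplus y=1$. The interval $[0,1]$ carries $x\oplus y=\min(1,x+y)$, $x^*=1-x$, and $[0,1]^X$ (the fuzzy subsets of $X$) the pointwise operations. An ideal is a subset that contains $0$, is downward closed and is closed under $\oplus$; $\mathrm{Max}\,A$ is the set of maximal (proper) ideals. For $M\in\mathrm{Max}\,A$ there is a unique embedding $\iota_M:A/M\to[0,1]$; for $a\in A$ let $\widehat a\in[0,1]^{\mathrm{Max}\,A}$, $\widehat a(M)=\iota_M(a/M)$. $A$ is simple if $\{0\}$ is its only proper ideal, and semisimple if it is a subdirect product of simple algebras. A subset $X\subseteq A$ is a cut if $X=luX$, where $u$ and $l$ denote the sets of upper and of lower bounds; a cut $X$ of a semisimple algebra is a limit cut if $\bigwedge\{d(\widehat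 a,\widehat b)\mid a\in X,\ b\in uX\}=0$ in $[0,1]^{\mathrm{Max}\,A}$. $A$ is limit cut complete (lcc) if it is semisimple and every limit cut of $A$ has a supremum in $A$. $\mathcal{MV}^{\mathrm{lcc}}$ is the full subcategory of lcc algebras in the category of MV-algebras and their homomorphisms. An MV-topological space is a set $X$ with a family $\Omega\subseteq[0,1]^X$ of open fuzzy sets that contains $\mathbf 0,\mathbf 1$ and is closed under arbitrary joins and under $\odot,\oplus,\wedge$. A map $f:X\to Y$ is MV-continuous if $o\circ f$ is open in $X$ for every open $o$ of $Y$; an MV-homeomorphism is a bijection that is MV-continuous together with its inverse. Closed fuzzy sets are the $o^*$ with $o$ open, and clopen means open and closed. The space is compact if for every family $\Gamma$ of open fuzzy sets with $\bigvee\Gamma=\mathbf 1$ there are finitely many $o_1,\dots,o_n\in\Gamma$, repetitions allowed, with $o_1\oplus\cdots\oplus o_n=\mathbf 1$; Hausdorff if for all $x\neq y$ there are open $o,o'$ with $o(x)=o'(y)=1$ and $o\wedge o'=\mathbf 0$; zero-dimensional if there is a set of clopen fuzzy sets such that every open one is a join of some of them. A Stone MV-space is a compact, Hausdorff, zero-dimensional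 MV-topological space; ${}^{\mathrm{MV}}\mathrm{Stone}$ is the full subcategory of Stone MV-spaces in the category of MV-topological spaces and MV-continuous maps. $\mathrm{Clop}$ is the contravariant functor that sends an MV-topological space $\tau=(X,\Omega)$ to the subalgebra of $[0,1]^X$ of its clopen fuzzy sets, and $f$ to $o\mapsto o\circ f$. $\mathrm{Max}$ is the contravariant functor that sends an MV-algebra $A$ to $\mathrm{Max}\,A$ with the MV-topology whose open sets are the joins of sets of $\widehat a$'s, and a homomorphism $h$ to $N\mapsto h^{-1}(N)$. **Theorem 4.9 (Duality theorem).** $\mathrm{Max}$ sends lcc MV-algebras to Stone MV-spaces, $\mathrm{Clop}$ sends Stone MV-spaces to lcc MV-algebras, and the restricted functors form a duality (a contravariant equivalence of categories, quasi-inverse to each other) between $\mathcal{MV}^{\mathrm{lcc}}$ and ${}^{\mathrm{MV}}\mathrm{Stone}$. In particular $\mathrm{Clop}\,\mathrm{Max}\,A\cong A$ for every lcc MV-algebra $A$, and $\mathrm{Max}\,\mathrm{Clop}\,\tau$ is MV-homeomorphic to $\tau$ for every Stone MV-space $\tau$. -/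

import Mathlib

open CategoryTheory

universe u

/-! ### MV-algebras -/

/-- An MV-algebra `⟨A, ⊕, *, 0⟩`; the constant `1` is an abbreviation for `0*`. -/
class MVAlgebra (A : Type*) extends Zero A, One A where
  oplus : A → A → A
  star : A → A
  oplus_assoc : ∀ x y z, oplus (oplus x y) z = oplus x (oplus y z)
  oplus_comm : ∀ x y, oplus x y = oplus y x
  oplus_zero : ∀ x, oplus x 0 = x
  star_invol : ∀ x, star (star x) = x
  one_eq : (1 : A) = star 0
  oplus_one : ∀ x, oplus x 1 = 1
  luk : ∀ x y, oplus (star (oplus (star x) y)) y = oplus (star (oplus (star y) x)) x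

namespace MVAlgebra

infixl:65 " ⊕ₘ " => MVAlgebra.oplus
prefix:max "∼" => MVAlgebra.star

section Basic

variable {A : Type*} [MVAlgebra A]

/-- The strong conjunction `x ⊙ y = (x* ⊕ y*)*`. -/
def odot (x y : A) : A := ∼(∼x ⊕ₘ ∼y)

infixl:70 " ⊙ₘ " => MVAlgebra.odot

/-- The truncated difference `x ⊖ y = x ⊙ y*`. -/
def ominus (x y : A) : A := x ⊙ₘ ∼y

/-- Chang's distance `d(x, y) = (x ⊖ y) ⊕ (y ⊖ x)`. -/
def mvdist (x y : A) : A := ominus x y ⊕ₘ ominus y x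

/-- The natural order: `x ≤ y` iff `x* ⊕ y = 1`. -/
def le (x y : A) : Prop := ∼x ⊕ₘ y = 1

infix:50 " ≤ₘ " => MVAlgebra.le

/-- Sum `x₁ ⊕ ⋯ ⊕ xₙ` of a finite family; the empty sum is `0`. -/
def sumList (l : List A) : A := l.foldr (fun x y => x ⊕ₘ y) 0

/-- The multiple `n x = x ⊕ ⋯ ⊕ x`. -/
def nmul : ℕ → A → A
  | 0, _ => 0
  | n + 1, x => nmul n x ⊕ₘ x

theorem left_comm (x y z : A) : x ⊕ₘ (y ⊕ₘ z) = y ⊕ₘ (x ⊕ₘ z) := by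
  rw [← oplus_assoc, oplus_comm x y, oplus_assoc]

theorem zero_oplus (x : A) : 0 ⊕ₘ x = x := by rw [oplus_comm, oplus_zero]

theorem one_oplus (x : A) : 1 ⊕ₘ x = 1 := by rw [oplus_comm, oplus_one]

theorem star_bot : ∼(0 : A) = 1 := one_eq.symm

theorem star_top : ∼(1 : A) = 0 := by rw [one_eq, star_invol]

theorem star_inj {x y : A} (h : ∼x = ∼y) : x = y := by
  rw [← star_invol x, h, star_invol]

theorem star_oplus_self (x : A) : ∼x ⊕ₘ x = 1 := by
  have h := luk x 1
  rw [oplus_one, star_top, zero_oplus] at h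
  exact h.symm

theorem oplus_star_self (x : A) : x ⊕ₘ ∼x = 1 := by rw [oplus_comm, star_oplus_self]

theorem star_odot (x y : A) : ∼(x ⊙ₘ y) = ∼x ⊕ₘ ∼y := star_invol _

theorem star_oplus (x y : A) : ∼(x ⊕ₘ y) = ∼x ⊙ₘ ∼y := by
  simp only [odot, star_invol]

theorem odot_comm (x y : A) : x ⊙ₘ y = y ⊙ₘ x := by simp only [odot, oplus_comm]

theorem odot_assoc (x y z : A) : x ⊙ₘ y ⊙ₘ z = x ⊙ₘ (y ⊙ₘ z) := by
  simp only [odot, star_invol, oplus_assoc]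

theorem odot_left_comm (x y z : A) : x ⊙ₘ (y ⊙ₘ z) = y ⊙ₘ (x ⊙ₘ z) := by
  rw [← odot_assoc, odot_comm x y, odot_assoc]

theorem odot_one (x : A) : x ⊙ₘ 1 = x := by simp only [odot, star_top, oplus_zero, star_invol]

theorem one_odot (x : A) : 1 ⊙ₘ x = x := by rw [odot_comm, odot_one]

theorem odot_zero (x : A) : x ⊙ₘ 0 = 0 := by
  simp only [odot, star_bot, oplus_one, star_top]

theorem zero_odot (x : A) : 0 ⊙ₘ x = 0 := by rw [odot_comm, odot_zero]

theorem odot_star_self (x : A) : x ⊙ₘ ∼x = 0 := by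
  simp only [odot, star_invol, star_oplus_self, star_top]

theorem star_odot_self (x : A) : ∼x ⊙ₘ x = 0 := by rw [odot_comm, odot_star_self]

theorem le_iff_exists {x y : A} : x ≤ₘ y ↔ ∃ z, x ⊕ₘ z = y := by
  constructor
  · intro h
    refine ⟨∼(∼y ⊕ₘ x), ?_⟩
    have h2 := luk x y
    rw [show ∼x ⊕ₘ y = 1 from h, star_top, zero_oplus] at h2
    rw [oplus_comm]
    exact h2.symm
  · rintro ⟨z, rfl⟩
    rw [le, ← oplus_assoc, star_oplus_self, one_oplus]

theorem le_refl (x : A) : x ≤ₘ x := star_oplus_self x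

theorem le_trans {x y z : A} (h1 : x ≤ₘ y) (h2 : y ≤ₘ z) : x ≤ₘ z := by
  obtain ⟨a, rfl⟩ := le_iff_exists.1 h1
  obtain ⟨b, rfl⟩ := le_iff_exists.1 h2
  exact le_iff_exists.2 ⟨a ⊕ₘ b, by rw [oplus_assoc]⟩

theorem le_antisymm {x y : A} (h1 : x ≤ₘ y) (h2 : y ≤ₘ x) : x = y := by
  have h := luk x y
  rw [show ∼x ⊕ₘ y = 1 from h1, show ∼y ⊕ₘ x = 1 from h2, star_top, zero_oplus, zero_oplus] at h
  exact h.symm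

theorem zero_le (x : A) : 0 ≤ₘ x := le_iff_exists.2 ⟨x, zero_oplus x⟩

theorem le_one (x : A) : x ≤ₘ 1 := oplus_one _

theorem le_zero {x : A} (h : x ≤ₘ 0) : x = 0 := le_antisymm h (zero_le x)

theorem one_le {x : A} (h : 1 ≤ₘ x) : x = 1 := le_antisymm (le_one x) h

theorem le_oplus_left (x y : A) : x ≤ₘ x ⊕ₘ y := le_iff_exists.2 ⟨y, rfl⟩

theorem le_oplus_right (x y : A) : x ≤ₘ y ⊕ₘ x := le_iff_exists.2 ⟨y, oplus_comm _ _⟩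

theorem oplus_le_oplus {x y z w : A} (h1 : x ≤ₘ y) (h2 : z ≤ₘ w) : x ⊕ₘ z ≤ₘ y ⊕ₘ w := by
  obtain ⟨a, rfl⟩ := le_iff_exists.1 h1
  obtain ⟨b, rfl⟩ := le_iff_exists.1 h2
  refine le_iff_exists.2 ⟨a ⊕ₘ b, ?_⟩
  rw [oplus_assoc, oplus_assoc, left_comm z a b]

theorem star_le_star {x y : A} (h : x ≤ₘ y) : ∼y ≤ₘ ∼x := by
  rw [le, star_invol, oplus_comm]
  exact h

theorem odot_le_odot {x y z w : A} (h1 : x ≤ₘ y) (h2 : z ≤ₘ w) : x ⊙ₘ z ≤ₘ y ⊙ₘ w :=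
  star_le_star (oplus_le_oplus (star_le_star h1) (star_le_star h2))

theorem odot_le_iff {x y z : A} : x ⊙ₘ z ≤ₘ y ↔ x ≤ₘ ∼z ⊕ₘ y := by
  rw [le, le, star_odot, oplus_assoc]

theorem odot_le_left (x y : A) : x ⊙ₘ y ≤ₘ x := by
  have h := odot_le_odot (le_refl x) (le_one y)
  rwa [odot_one] at h

theorem odot_le_right (x y : A) : x ⊙ₘ y ≤ₘ y := by rw [odot_comm]; exact odot_le_left _ _

theorem odot_le_oplus (x y : A) : x ⊙ₘ y ≤ₘ x ⊕ₘ y := le_trans (odot_le_left x y) (le_oplus_left x y)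

theorem odot_eq_zero_iff {x y : A} : x ⊙ₘ y = 0 ↔ x ≤ₘ ∼y := by
  rw [le]
  constructor
  · intro h
    rw [← star_odot, h, star_bot]
  · intro h
    rw [odot, h, star_top]

theorem ominus_eq_zero_iff {x y : A} : ominus x y = 0 ↔ x ≤ₘ y := by
  rw [ominus, odot_eq_zero_iff, star_invol]

/-- `(x ⊖ y) ⊕ y` is the join of `x` and `y`. -/
theorem ominus_oplus_of_le {x y : A} (h : y ≤ₘ x) : x ⊙ₘ ∼y ⊕ₘ y = x := by
  have h2 := luk x y
  rw [show ∼y ⊕ₘ x = 1 from h, star_top, zero_oplus] at h2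
  rw [odot, star_invol]
  exact h2

theorem le_ominus_oplus (x y : A) : x ≤ₘ ominus x y ⊕ₘ y := by
  rw [oplus_comm, ← star_invol y, ← odot_le_iff]
  simp only [ominus, star_invol]
  exact le_refl _

theorem inf_comm (x y : A) : x ⊙ₘ (∼x ⊕ₘ y) = y ⊙ₘ (∼y ⊕ₘ x) := by
  apply star_inj
  rw [star_odot, star_odot]
  have h := luk (∼x) (∼y)
  rw [star_invol, star_invol] at h
  have e1 : ∼(x ⊕ₘ ∼y) = ∼(∼y ⊕ₘ x) := by rw [oplus_comm]
  have e2 : ∼(y ⊕ₘ ∼x) = ∼(∼x ⊕ₘ y) := by rw [oplus_comm]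
  rw [e1, e2] at h
  rw [oplus_comm (∼x), oplus_comm (∼y)]
  exact h.symm

theorem inf_of_le {x y : A} (h : x ≤ₘ y) : y ⊙ₘ (∼y ⊕ₘ x) = x := by
  rw [← inf_comm, show ∼x ⊕ₘ y = 1 from h, odot_one]

/-- Prelinearity: `(x ⊖ y) ∧ (y ⊖ x) = 0`. -/
theorem prelinear (x y : A) :
    (x ⊙ₘ ∼y) ⊙ₘ (∼(x ⊙ₘ ∼y) ⊕ₘ (y ⊙ₘ ∼x)) = 0 := by
  set d := y ⊙ₘ ∼x with hd
  have hd' : ∼d = ∼y ⊕ₘ x := by rw [hd, star_odot, star_invol]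
  have e1 : ∼(x ⊙ₘ ∼y) ⊕ₘ d = ∼x ⊕ₘ (y ⊕ₘ d) := by
    rw [star_odot, star_invol, oplus_assoc]
  rw [e1, odot_comm x, odot_assoc, inf_comm, ← odot_assoc]
  have e2 : ∼y ⊙ₘ (y ⊕ₘ d) = d ⊙ₘ (∼d ⊕ₘ ∼y) := by
    have := inf_comm (∼y) d
    rwa [star_invol] at this
  rw [e2, star_oplus]
  set w := ∼y ⊙ₘ ∼d with hw
  have e3 : ∼x ⊙ₘ (x ⊕ₘ w) = w ⊙ₘ (∼w ⊕ₘ ∼x) := by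
    have := inf_comm (∼x) w
    rwa [star_invol] at this
  have e4 : y ⊙ₘ w = 0 := by rw [hw, ← odot_assoc, odot_star_self, zero_odot]
  have e5 : d ⊙ₘ (w ⊕ₘ x) = 0 := by
    rw [hd, odot_assoc, oplus_comm w, e3, ← odot_assoc, e4, zero_odot]
  rw [odot_assoc, odot_left_comm, e5, odot_zero]

theorem nmul_odot_star {u v : A} (h : v ⊙ₘ ∼u = v) (n : ℕ) : v ⊙ₘ ∼(nmul n u) = v := by
  induction n with
  | zero => rw [nmul, star_bot, odot_one]
  | succ n ih => rw [nmul, star_oplus, ← odot_assoc, ih, h]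

theorem carry_one {x y z : A} (h1 : x ⊙ₘ y = 0) (h2 : y ⊙ₘ z = 0) :
    (x ⊕ₘ y) ⊙ₘ z = x ⊙ₘ (y ⊕ₘ z) := by
  have hx : ∼x ⊙ₘ ∼y ⊕ₘ y = ∼x := by
    apply ominus_oplus_of_le
    rw [← odot_eq_zero_iff, odot_comm, h1]
  have hz : ∼z ⊙ₘ ∼y ⊕ₘ y = ∼z := by
    apply ominus_oplus_of_le
    rwa [← odot_eq_zero_iff]
  apply star_inj
  rw [star_odot, star_odot, star_oplus, star_oplus]
  calc ∼x ⊙ₘ ∼y ⊕ₘ ∼z = ∼x ⊙ₘ ∼y ⊕ₘ (∼z ⊙ₘ ∼y ⊕ₘ y) := by rw [hz]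
    _ = (∼x ⊙ₘ ∼y ⊕ₘ y) ⊕ₘ ∼z ⊙ₘ ∼y := by
      rw [oplus_comm (∼z ⊙ₘ ∼y) y, oplus_assoc]
    _ = ∼x ⊕ₘ ∼y ⊙ₘ ∼z := by rw [hx, odot_comm (∼z)]

theorem carry_two {x y z : A} (h1 : x ⊕ₘ y = 1) (h2 : y ⊕ₘ z = 1) :
    x ⊙ₘ y ⊕ₘ z = x ⊕ₘ y ⊙ₘ z := by
  apply star_inj
  rw [star_oplus, star_oplus, star_odot, star_odot]
  apply carry_one
  · rw [← star_oplus, h1, star_top]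
  · rw [← star_oplus, h2, star_top]

theorem carry_three {x y z : A} (h1 : x ⊙ₘ y = 0) (h2 : y ⊕ₘ z = 1) :
    (x ⊕ₘ y) ⊙ₘ z = x ⊕ₘ y ⊙ₘ z := by
  have hzy : ∼z ≤ₘ y := by rw [le, star_invol, oplus_comm]; exact h2
  have hy : y ⊙ₘ z ⊕ₘ ∼z = y := by
    have := ominus_oplus_of_le hzy
    rwa [star_invol] at this
  have hx : x ≤ₘ ∼y := odot_eq_zero_iff.1 h1
  have hyz : ∼y ≤ₘ z := by rw [le, star_invol]; exact h2
  have hle : x ⊕ₘ y ⊙ₘ z ≤ₘ z := by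
    refine le_trans (oplus_le_oplus hx (le_refl _)) ?_
    have := ominus_oplus_of_le hyz
    rw [star_invol, oplus_comm, odot_comm] at this
    rw [this]
    exact le_refl _
  calc (x ⊕ₘ y) ⊙ₘ z = (x ⊕ₘ (y ⊙ₘ z ⊕ₘ ∼z)) ⊙ₘ z := by rw [hy]
    _ = z ⊙ₘ (∼z ⊕ₘ (x ⊕ₘ y ⊙ₘ z)) := by
      rw [← oplus_assoc, odot_comm, oplus_comm _ (∼z)]
    _ = x ⊕ₘ y ⊙ₘ z := inf_of_le hle

end Basic

/-! ### Homomorphisms, standard algebra, powers -/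

/-- The standard MV-algebra `[0, 1]`, with `x ⊕ y = min (1, x + y)` and `x* = 1 - x`. -/
noncomputable instance instUnitInterval : MVAlgebra unitInterval where
  oplus x y := ⟨min 1 (x + y), le_min zero_le_one (add_nonneg x.2.1 y.2.1), min_le_left _ _⟩
  star x := ⟨1 - x, sub_nonneg.2 x.2.2, sub_le_self _ x.2.1⟩
  oplus_assoc x y z := by
    obtain ⟨x, hx0, hx1⟩ := x; obtain ⟨y, hy0, hy1⟩ := y; obtain ⟨z, hz0, hz1⟩ := z
    apply Subtype.ext
    simp only [min_def]
    split_ifs <;> linarith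
  oplus_comm x y := by apply Subtype.ext; simp only [add_comm]
  oplus_zero x := by
    apply Subtype.ext
    simpa using x.2.2
  star_invol x := by apply Subtype.ext; simp
  one_eq := by apply Subtype.ext; simp
  oplus_one x := by
    apply Subtype.ext
    simpa using x.2.1
  luk x y := by
    obtain ⟨x, hx0, hx1⟩ := x; obtain ⟨y, hy0, hy1⟩ := y
    apply Subtype.ext
    simp only [min_def]
    split_ifs <;> linarith

/-- Products of MV-algebras, with pointwise operations; in particular the algebra `[0, 1]^X` of
fuzzy subsets of `X`. -/
instance instPi {ι : Type*} (B : ι → Type*) [∀ i, MVAlgebra (B i)] : MVAlgebra (∀ i, B i) where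
  oplus f g := fun i => f i ⊕ₘ g i
  star f := fun i => ∼(f i)
  oplus_assoc _ _ _ := funext fun _ => oplus_assoc _ _ _
  oplus_comm _ _ := funext fun _ => oplus_comm _ _
  oplus_zero _ := funext fun _ => oplus_zero _
  star_invol _ := funext fun _ => star_invol _
  one_eq := funext fun _ => one_eq
  oplus_one _ := funext fun _ => oplus_one _
  luk _ _ := funext fun _ => luk _ _

end MVAlgebra

section Ideals

open MVAlgebra

/-- MV-algebra homomorphisms. -/
@[ext]
structure MVHom (A B : Type*) [MVAlgebra A] [MVAlgebra B] where
  toFun : A → B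
  map_zero' : toFun 0 = 0
  map_oplus' : ∀ x y, toFun (x ⊕ₘ y) = toFun x ⊕ₘ toFun y
  map_star' : ∀ x, toFun (∼x) = ∼(toFun x)

namespace MVHom

variable {A B C : Type*} [MVAlgebra A] [MVAlgebra B] [MVAlgebra C]

instance : FunLike (MVHom A B) A B where
  coe f := f.toFun
  coe_injective := fun _ _ h => MVHom.ext h

theorem map_zero (f : MVHom A B) : f 0 = 0 := f.map_zero'

theorem map_oplus (f : MVHom A B) (x y : A) : f (x ⊕ₘ y) = f x ⊕ₘ f y := f.map_oplus' x y

theorem map_star (f : MVHom A B) (x : A) : f (∼x) = ∼(f x) := f.map_star' x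

theorem map_one (f : MVHom A B) : f 1 = 1 := by rw [one_eq, map_star, map_zero, ← one_eq]

theorem map_odot (f : MVHom A B) (x y : A) : f (x ⊙ₘ y) = f x ⊙ₘ f y := by
  simp only [odot, map_star, map_oplus]

theorem map_ominus (f : MVHom A B) (x y : A) : f (ominus x y) = ominus (f x) (f y) := by
  simp only [ominus, map_odot, map_star]

theorem map_nmul (f : MVHom A B) (n : ℕ) (x : A) : f (nmul n x) = nmul n (f x) := by
  induction n with
  | zero => exact f.map_zero
  | succ n ih => rw [nmul, map_oplus, ih, nmul]

theorem map_le (f : MVHom A B) {x y : A} (h : x ≤ₘ y) : f x ≤ₘ f y := by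
  rw [le, ← map_star, ← map_oplus, show ∼x ⊕ₘ y = 1 from h, map_one]

/-- The identity homomorphism. -/
def id (A : Type*) [MVAlgebra A] : MVHom A A := ⟨fun x => x, rfl, fun _ _ => rfl, fun _ => rfl⟩

/-- Composition `g ∘ f`. -/
def comp (g : MVHom B C) (f : MVHom A B) : MVHom A C where
  toFun x := g (f x)
  map_zero' := by rw [f.map_zero, g.map_zero]
  map_oplus' x y := by rw [f.map_oplus, g.map_oplus]
  map_star' x := by rw [f.map_star, g.map_star]

@[simp]
theorem comp_apply (g : MVHom B C) (f : MVHom A B) (x : A) : g.comp f x = g (f x) := rfl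

end MVHom

/-! ### Ideals and quotients -/

/-- Ideals of an MV-algebra: downward closed subsets containing `0` and closed under `⊕`. -/
@[ext]
structure MVIdeal (A : Type*) [MVAlgebra A] where
  carrier : Set A
  zero_mem' : (0 : A) ∈ carrier
  oplus_mem' : ∀ x ∈ carrier, ∀ y ∈ carrier, x ⊕ₘ y ∈ carrier
  mem_of_le' : ∀ x y, x ≤ₘ y → y ∈ carrier → x ∈ carrier

namespace MVIdeal

section

variable {A : Type*} [MVAlgebra A]

instance : Membership A (MVIdeal A) := ⟨fun I x => x ∈ I.carrier⟩

theorem zero_mem (I : MVIdeal A) : (0 : A) ∈ I := I.zero_mem'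

theorem oplus_mem (I : MVIdeal A) {x y : A} (hx : x ∈ I) (hy : y ∈ I) : x ⊕ₘ y ∈ I :=
  I.oplus_mem' x hx y hy

theorem mem_of_le (I : MVIdeal A) {x y : A} (h : x ≤ₘ y) (hy : y ∈ I) : x ∈ I :=
  I.mem_of_le' x y h hy

theorem nmul_mem (I : MVIdeal A) {x : A} (hx : x ∈ I) (n : ℕ) : nmul n x ∈ I := by
  induction n with
  | zero => exact I.zero_mem
  | succ n ih => exact I.oplus_mem ih hx

/-- An ideal is proper if it is not the whole algebra. -/
def IsProper (I : MVIdeal A) : Prop := I.carrier ≠ Set.univ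

theorem isProper_iff (I : MVIdeal A) : I.IsProper ↔ (1 : A) ∉ I := by
  constructor
  · intro h h1
    exact h (Set.eq_univ_of_forall fun x => I.mem_of_le (le_one x) h1)
  · intro h h1
    exact h (show (1 : A) ∈ I.carrier from h1 ▸ Set.mem_univ _)

/-- Maximal ideals: maximal elements among the proper ideals. -/
def IsMaximal (I : MVIdeal A) : Prop :=
  I.IsProper ∧ ∀ J : MVIdeal A, J.IsProper → I.carrier ⊆ J.carrier → J.carrier = I.carrier

theorem mvdist_mem_iff (I : MVIdeal A) (x y : A) :
    mvdist x y ∈ I ↔ ominus x y ∈ I ∧ ominus y x ∈ I :=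
  ⟨fun h => ⟨I.mem_of_le (le_oplus_left _ _) h, I.mem_of_le (le_oplus_right _ _) h⟩,
    fun h => I.oplus_mem h.1 h.2⟩

theorem ominus_le_iff {x y z : A} : ominus x y ≤ₘ z ↔ x ≤ₘ y ⊕ₘ z := by
  rw [ominus, odot_le_iff, star_invol]

theorem ominus_trans (x y z : A) : ominus x z ≤ₘ ominus x y ⊕ₘ ominus y z := by
  rw [ominus_le_iff]
  refine le_trans (le_ominus_oplus x y) ?_
  rw [left_comm]
  refine oplus_le_oplus (le_refl _) ?_
  rw [oplus_comm]
  exact le_ominus_oplus y z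

theorem ominus_oplus_le (x y z w : A) :
    ominus (x ⊕ₘ y) (z ⊕ₘ w) ≤ₘ ominus x z ⊕ₘ ominus y w := by
  rw [ominus_le_iff]
  refine le_trans (oplus_le_oplus (le_ominus_oplus x z) (le_ominus_oplus y w)) ?_
  have : ominus x z ⊕ₘ z ⊕ₘ (ominus y w ⊕ₘ w) = z ⊕ₘ w ⊕ₘ (ominus x z ⊕ₘ ominus y w) := by
    rw [oplus_comm (ominus x z) z, oplus_comm (ominus y w) w, oplus_assoc, oplus_assoc,
      left_comm (ominus x z)]
  rw [this]
  exact le_refl _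

theorem star_ominus_star (x y : A) : ominus (∼x) (∼y) = ominus y x := by
  simp only [ominus, star_invol]
  exact odot_comm _ _

/-- The congruence associated to an ideal: `x ~ y` iff `d(x, y) ∈ I`. -/
def setoid (I : MVIdeal A) : Setoid A where
  r x y := mvdist x y ∈ I
  iseqv := by
    refine ⟨fun x => ?_, fun {x y} h => ?_, fun {x y z} h1 h2 => ?_⟩
    · rw [mvdist_mem_iff, ominus_eq_zero_iff.2 (le_refl x)]
      exact ⟨I.zero_mem, I.zero_mem⟩
    · rw [mvdist_mem_iff] at h ⊢
      exact h.symm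
    · rw [mvdist_mem_iff] at h1 h2 ⊢
      exact ⟨I.mem_of_le (ominus_trans x y z) (I.oplus_mem h1.1 h2.1),
        I.mem_of_le (ominus_trans z y x) (I.oplus_mem h2.2 h1.2)⟩

/-- The quotient algebra `A / I`. -/
def Quot (I : MVIdeal A) : Type _ := Quotient I.setoid

/-- The class `a / I`. -/
def cls (I : MVIdeal A) (a : A) : I.Quot := Quotient.mk I.setoid a

theorem cls_eq_iff (I : MVIdeal A) {a b : A} : I.cls a = I.cls b ↔ mvdist a b ∈ I :=
  ⟨fun h => Quotient.exact h, fun h => Quotient.sound (s := I.setoid) h⟩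

theorem cls_surjective (I : MVIdeal A) : Function.Surjective I.cls := Quotient.exists_rep

instance (I : MVIdeal A) : MVAlgebra I.Quot where
  zero := I.cls 0
  one := I.cls 1
  oplus := Quotient.map₂ (fun x y => x ⊕ₘ y) (by
    intro x z h1 y w h2
    have h1' : mvdist x z ∈ I := h1
    have h2' : mvdist y w ∈ I := h2
    change mvdist (x ⊕ₘ y) (z ⊕ₘ w) ∈ I
    rw [mvdist_mem_iff] at h1' h2' ⊢
    exact ⟨I.mem_of_le (ominus_oplus_le x y z w) (I.oplus_mem h1'.1 h2'.1),
      I.mem_of_le (ominus_oplus_le z w x y) (I.oplus_mem h1'.2 h2'.2)⟩)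
  star := Quotient.map (fun x => ∼x) (by
    intro x y h
    have h' : mvdist x y ∈ I := h
    change mvdist (∼x) (∼y) ∈ I
    rw [mvdist_mem_iff] at h' ⊢
    rw [star_ominus_star, star_ominus_star]
    exact h'.symm)
  oplus_assoc := by
    rintro ⟨x⟩ ⟨y⟩ ⟨z⟩
    exact congrArg I.cls (oplus_assoc x y z)
  oplus_comm := by
    rintro ⟨x⟩ ⟨y⟩
    exact congrArg I.cls (oplus_comm x y)
  oplus_zero := by
    rintro ⟨x⟩
    exact congrArg I.cls (oplus_zero x)
  star_invol := by
    rintro ⟨x⟩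
    exact congrArg I.cls (star_invol x)
  one_eq := congrArg I.cls one_eq
  oplus_one := by
    rintro ⟨x⟩
    exact congrArg I.cls (oplus_one x)
  luk := by
    rintro ⟨x⟩ ⟨y⟩
    exact congrArg I.cls (luk x y)

/-- The natural projection `A → A / I`. -/
def proj (I : MVIdeal A) : MVHom A I.Quot :=
  ⟨I.cls, rfl, fun _ _ => rfl, fun _ => rfl⟩

theorem proj_surjective (I : MVIdeal A) : Function.Surjective I.proj := I.cls_surjective

theorem proj_eq_zero_iff (I : MVIdeal A) {a : A} : I.proj a = 0 ↔ a ∈ I := by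
  have h : I.proj a = 0 ↔ mvdist a 0 ∈ I := I.cls_eq_iff
  rw [h, mvdist, ominus_eq_zero_iff.2 (zero_le a), oplus_zero, ominus, star_bot, odot_one]

/-- The ideal generated by `I` and `a`. -/
def adjoin (I : MVIdeal A) (a : A) : MVIdeal A where
  carrier := {x | ∃ y ∈ I, ∃ n, x ≤ₘ y ⊕ₘ nmul n a}
  zero_mem' := ⟨0, I.zero_mem, 0, zero_le _⟩
  oplus_mem' := by
    rintro x ⟨y, hy, n, hx⟩ x' ⟨y', hy', n', hx'⟩
    refine ⟨y ⊕ₘ y', I.oplus_mem hy hy', n + n', ?_⟩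
    refine le_trans (oplus_le_oplus hx hx') ?_
    have h : ∀ k, nmul (n + k) a = nmul n a ⊕ₘ nmul k a := by
      intro k
      induction k with
      | zero => exact (oplus_zero _).symm
      | succ k ih => rw [← add_assoc, nmul, ih, nmul, oplus_assoc]
    rw [h, oplus_assoc, oplus_assoc, left_comm (nmul n a) y']
    exact le_refl _
  mem_of_le' := by
    rintro x y hxy ⟨z, hz, n, hy⟩
    exact ⟨z, hz, n, le_trans hxy hy⟩

theorem IsMaximal.exists_nmul {I : MVIdeal A} (hI : I.IsMaximal) {a : A} (ha : a ∉ I) :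
    ∃ n, ∼(nmul n a) ∈ I := by
  have h1 : (1 : A) ∈ I.adjoin a := by
    by_contra h
    have hJ : (I.adjoin a).carrier = I.carrier := by
      refine hI.2 _ ((isProper_iff _).2 h) fun x hx => ⟨x, hx, 0, ?_⟩
      exact le_oplus_left _ _
    apply ha
    change a ∈ I.carrier
    rw [← hJ]
    refine ⟨0, I.zero_mem, 1, ?_⟩
    rw [nmul, nmul, zero_oplus, zero_oplus]
    exact le_refl _
  obtain ⟨y, hy, n, hn⟩ := h1
  refine ⟨n, I.mem_of_le ?_ hy⟩
  rw [le, star_invol, oplus_comm]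
  exact one_le hn

end

/-- The kernel of a homomorphism. -/
def ker {A B : Type*} [MVAlgebra A] [MVAlgebra B] (f : MVHom A B) : MVIdeal A where
  carrier := {x | f x = 0}
  zero_mem' := f.map_zero
  oplus_mem' := by
    intro x hx y hy
    change f x = 0 at hx; change f y = 0 at hy; change f (x ⊕ₘ y) = 0
    rw [f.map_oplus, hx, hy, oplus_zero]
  mem_of_le' := by
    intro x y h hy
    change f y = 0 at hy; change f x = 0
    have := f.map_le h
    rw [hy] at this
    exact le_zero this

/-- The preimage of an ideal under a homomorphism. -/
def comap {A B : Type*} [MVAlgebra A] [MVAlgebra B] (f : MVHom A B) (I : MVIdeal B) :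
    MVIdeal A where
  carrier := f ⁻¹' I.carrier
  zero_mem' := by
    rw [Set.mem_preimage, f.map_zero]
    exact I.zero_mem
  oplus_mem' := by
    intro x hx y hy
    rw [Set.mem_preimage, f.map_oplus]
    exact I.oplus_mem hx hy
  mem_of_le' := fun x y h hy => I.mem_of_le (f.map_le h) hy

end MVIdeal

end Ideals

/-! ### Simple chains embed into `[0, 1]`

The value `â(M)` is defined through the unique embedding of `A / M` into `[0, 1]`. Its existence is
shown here: a simple MV-chain is the unit interval of an archimedean totally ordered group. -/

section Chains

open MVAlgebra

/-- Non-trivial totally ordered archimedean MV-algebras. -/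
class IsSimpleMVChain (C : Type*) [MVAlgebra C] : Prop where
  zero_ne_one : (0 : C) ≠ 1
  total : ∀ x y : C, x ≤ₘ y ∨ y ≤ₘ x
  arch : ∀ x : C, x ≠ 0 → ∃ n, nmul n x = 1

/-- Elements of the totally ordered group of a chain `C`: an integer part together with a
fractional part in `C \ {1}`. -/
@[ext]
structure ChainGrp (C : Type*) [MVAlgebra C] where
  int : ℤ
  frac : C
  ne : frac ≠ 1

namespace ChainGrp

variable {C : Type*} [MVAlgebra C]

theorem odot_ne {x : C} (hx : x ≠ 1) (y : C) : x ⊙ₘ y ≠ 1 := by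
  intro h
  apply hx
  apply MVAlgebra.one_le
  rw [← h]
  exact odot_le_left _ _

open Classical in
/-- Addition with carry. -/
noncomputable def add (p q : ChainGrp C) : ChainGrp C :=
  if h : p.frac ⊕ₘ q.frac = 1 then ⟨p.int + q.int + 1, p.frac ⊙ₘ q.frac, odot_ne p.ne _⟩
  else ⟨p.int + q.int, p.frac ⊕ₘ q.frac, h⟩

theorem add_carry {p q : ChainGrp C} (h : p.frac ⊕ₘ q.frac = 1) :
    add p q = ⟨p.int + q.int + 1, p.frac ⊙ₘ q.frac, odot_ne p.ne _⟩ := dif_pos h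

theorem add_nocarry {p q : ChainGrp C} (h : p.frac ⊕ₘ q.frac ≠ 1) :
    add p q = ⟨p.int + q.int, p.frac ⊕ₘ q.frac, h⟩ := dif_neg h

theorem add_mk_carry {m n : ℤ} {x y : C} {hx : x ≠ 1} {hy : y ≠ 1} (h : x ⊕ₘ y = 1) :
    add ⟨m, x, hx⟩ ⟨n, y, hy⟩ = ⟨m + n + 1, x ⊙ₘ y, odot_ne hx _⟩ := dif_pos h

theorem add_mk_nocarry {m n : ℤ} {x y : C} {hx : x ≠ 1} {hy : y ≠ 1} (h : x ⊕ₘ y ≠ 1) :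
    add ⟨m, x, hx⟩ ⟨n, y, hy⟩ = ⟨m + n, x ⊕ₘ y, h⟩ := dif_neg h

theorem add_comm' (p q : ChainGrp C) : add p q = add q p := by
  by_cases h : p.frac ⊕ₘ q.frac = 1
  · rw [add_carry h, add_carry (by rwa [oplus_comm])]
    ext
    · change p.int + q.int + 1 = q.int + p.int + 1
      ring
    · exact odot_comm _ _
  · rw [add_nocarry h, add_nocarry (by rwa [oplus_comm])]
    ext
    · exact add_comm _ _
    · exact oplus_comm _ _

theorem star_ne {x : C} (hx : x ≠ 0) : ∼x ≠ 1 := by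
  intro h
  apply hx
  rw [← star_invol x, h, star_top]

noncomputable instance : Add (ChainGrp C) := ⟨add⟩

theorem add_def (p q : ChainGrp C) : p + q = add p q := rfl

variable [IsSimpleMVChain C]

theorem odot_eq_zero {x y : C} (h : x ⊕ₘ y ≠ 1) : x ⊙ₘ y = 0 := by
  rw [odot_eq_zero_iff]
  rcases IsSimpleMVChain.total x (∼y) with h1 | h1
  · exact h1
  · exfalso
    apply h
    rw [oplus_comm]
    rw [le, star_invol] at h1
    exact h1

theorem add_assoc' (p q r : ChainGrp C) : add (add p q) r = add p (add q r) := by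
  obtain ⟨m, x, hx⟩ := p
  obtain ⟨n, y, hy⟩ := q
  obtain ⟨k, z, hz⟩ := r
  have three : ∀ {m n k : ℤ} {x y z : C} (hx : x ≠ 1) (hy : y ≠ 1) (hz : z ≠ 1),
      x ⊕ₘ y ≠ 1 → y ⊕ₘ z = 1 →
      add (add ⟨m, x, hx⟩ ⟨n, y, hy⟩) ⟨k, z, hz⟩ = add ⟨m, x, hx⟩ (add ⟨n, y, hy⟩ ⟨k, z, hz⟩) := by
    intro m n k x y z hx hy hz h1 h2
    have e := carry_three (odot_eq_zero h1) h2
    rw [add_mk_nocarry h1, add_mk_carry h2]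
    have h3 : x ⊕ₘ y ⊕ₘ z = 1 := by rw [oplus_assoc, h2, oplus_one]
    have h4 : x ⊕ₘ y ⊙ₘ z ≠ 1 := by
      rw [← e, odot_comm]
      exact odot_ne hz _
    rw [add_mk_carry h3, add_mk_nocarry h4]
    ext
    · change m + n + k + 1 = m + (n + k + 1)
      ring
    · exact e
  by_cases h1 : x ⊕ₘ y = 1
  · by_cases h2 : y ⊕ₘ z = 1
    · have e := carry_two h1 h2
      rw [add_mk_carry h1, add_mk_carry h2]
      by_cases h3 : x ⊙ₘ y ⊕ₘ z = 1
      · rw [add_mk_carry h3, add_mk_carry (by rwa [e] at h3)]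
        ext
        · change m + n + 1 + k + 1 = m + (n + k + 1) + 1
          ring
        · exact odot_assoc _ _ _
      · rw [add_mk_nocarry h3, add_mk_nocarry (by rwa [e] at h3)]
        ext
        · change m + n + 1 + k = m + (n + k + 1)
          ring
        · exact e
    · have h := three (m := k) (n := n) (k := m) hz hy hx
        (by rwa [oplus_comm]) (by rwa [oplus_comm])
      generalize (⟨m, x, hx⟩ : ChainGrp C) = p at *
      generalize (⟨n, y, hy⟩ : ChainGrp C) = q at *
      generalize (⟨k, z, hz⟩ : ChainGrp C) = r at *
      rw [add_comm' (add p q) r, add_comm' p q, ← h, add_comm' p (add q r), add_comm' r q]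
  · by_cases h2 : y ⊕ₘ z = 1
    · exact three hx hy hz h1 h2
    · rw [add_mk_nocarry h1, add_mk_nocarry h2]
      by_cases h3 : x ⊕ₘ y ⊕ₘ z = 1
      · rw [add_mk_carry h3, add_mk_carry (by rwa [oplus_assoc] at h3)]
        ext
        · change m + n + k + 1 = m + (n + k) + 1
          ring
        · exact carry_one (odot_eq_zero h1) (odot_eq_zero h2)
      · rw [add_mk_nocarry h3, add_mk_nocarry (by rwa [oplus_assoc] at h3)]
        ext
        · exact add_assoc _ _ _
        · exact oplus_assoc _ _ _

open Classical in
/-- The opposite element. -/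
noncomputable def neg (p : ChainGrp C) : ChainGrp C :=
  if h : p.frac = 0 then ⟨-p.int, 0, IsSimpleMVChain.zero_ne_one⟩
  else ⟨-p.int - 1, ∼p.frac, star_ne h⟩

noncomputable instance : Zero (ChainGrp C) := ⟨⟨0, 0, IsSimpleMVChain.zero_ne_one⟩⟩

noncomputable instance : Neg (ChainGrp C) := ⟨neg⟩

noncomputable instance : AddCommGroup (ChainGrp C) where
  add_assoc := add_assoc'
  add_comm := add_comm'
  zero_add p := by
    change add ⟨0, 0, IsSimpleMVChain.zero_ne_one⟩ p = p
    have h : 0 ⊕ₘ p.frac ≠ 1 := by rw [zero_oplus]; exact p.ne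
    rw [add_nocarry h]
    ext
    · exact zero_add _
    · exact zero_oplus _
  add_zero p := by
    change add p ⟨0, 0, IsSimpleMVChain.zero_ne_one⟩ = p
    have h : p.frac ⊕ₘ 0 ≠ 1 := by rw [oplus_zero]; exact p.ne
    rw [add_nocarry h]
    ext
    · exact add_zero _
    · exact oplus_zero _
  neg_add_cancel p := by
    change add (neg p) p = ⟨0, 0, IsSimpleMVChain.zero_ne_one⟩
    obtain ⟨m, x, hx⟩ := p
    by_cases h : x = 0
    · subst h
      rw [neg, dif_pos rfl, add_nocarry (by rw [oplus_zero]; exact hx)]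
      ext
      · exact neg_add_cancel _
      · exact oplus_zero _
    · rw [neg, dif_neg h, add_carry (star_oplus_self x)]
      ext
      · change -m - 1 + m + 1 = 0
        ring
      · exact star_odot_self x
  nsmul := nsmulRec
  zsmul := zsmulRec

open Classical in
noncomputable instance : LinearOrder (ChainGrp C) where
  le p q := p.int < q.int ∨ (p.int = q.int ∧ p.frac ≤ₘ q.frac)
  le_refl p := Or.inr ⟨rfl, MVAlgebra.le_refl _⟩
  le_trans p q r h1 h2 := by
    rcases h1 with h1 | ⟨h1, h1'⟩ <;> rcases h2 with h2 | ⟨h2, h2'⟩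
    · exact Or.inl (h1.trans h2)
    · exact Or.inl (h2 ▸ h1)
    · exact Or.inl (h1 ▸ h2)
    · exact Or.inr ⟨h1.trans h2, MVAlgebra.le_trans h1' h2'⟩
  le_antisymm p q h1 h2 := by
    rcases h1 with h1 | ⟨h1, h1'⟩ <;> rcases h2 with h2 | ⟨h2, h2'⟩
    · omega
    · omega
    · omega
    · exact ChainGrp.ext h1 (MVAlgebra.le_antisymm h1' h2')
  le_total p q := by
    rcases lt_trichotomy p.int q.int with h | h | h
    · exact Or.inl (Or.inl h)
    · rcases IsSimpleMVChain.total p.frac q.frac with h' | h'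
      · exact Or.inl (Or.inr ⟨h, h'⟩)
      · exact Or.inr (Or.inr ⟨h.symm, h'⟩)
    · exact Or.inr (Or.inl h)
  toDecidableLE := fun _ _ => Classical.propDecidable _

theorem le_def (p q : ChainGrp C) :
    p ≤ q ↔ p.int < q.int ∨ (p.int = q.int ∧ p.frac ≤ₘ q.frac) := Iff.rfl

instance : IsOrderedAddMonoid (ChainGrp C) where
  add_le_add_left p q hpq r := by
    rw [add_def, add_def]
    obtain ⟨m, x, hx⟩ := p
    obtain ⟨n, y, hy⟩ := q
    obtain ⟨k, z, hz⟩ := r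
    by_cases h1 : x ⊕ₘ z = 1 <;> by_cases h2 : y ⊕ₘ z = 1
    · rw [add_carry h1, add_carry h2]
      rcases hpq with h | ⟨h, h'⟩
      · left
        change m + k + 1 < n + k + 1
        have h : m < n := h
        omega
      · right
        have h : m = n := h
        exact ⟨congrArg (fun t => t + k + 1) h, odot_le_odot h' (MVAlgebra.le_refl _)⟩
    · rw [add_carry h1, add_nocarry h2]
      rcases hpq with h | ⟨h, h'⟩
      · have h : m < n := h
        rcases (show m + 1 ≤ n from h).lt_or_eq with h3 | h3
        · left
          change m + k + 1 < n + k
          omega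
        · right
          refine ⟨?_, MVAlgebra.le_trans (odot_le_right x z) (le_oplus_right z y)⟩
          change m + k + 1 = n + k
          omega
      · exfalso
        apply h2
        apply MVAlgebra.one_le
        rw [← h1]
        exact oplus_le_oplus h' (MVAlgebra.le_refl _)
    · rw [add_nocarry h1, add_carry h2]
      left
      change m + k < n + k + 1
      rcases hpq with h | ⟨h, _⟩
      · have h : m < n := h
        omega
      · have h : m = n := h
        omega
    · rw [add_nocarry h1, add_nocarry h2]
      rcases hpq with h | ⟨h, h'⟩
      · left
        change m + k < n + k
        have h : m < n := h
        omega
      · right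
        have h : m = n := h
        exact ⟨congrArg (fun t => t + k) h, oplus_le_oplus h' (MVAlgebra.le_refl _)⟩

noncomputable instance : One (ChainGrp C) := ⟨⟨1, 0, IsSimpleMVChain.zero_ne_one⟩⟩

theorem one_def : (1 : ChainGrp C) = ⟨1, 0, IsSimpleMVChain.zero_ne_one⟩ := rfl

theorem zero_def : (0 : ChainGrp C) = ⟨0, 0, IsSimpleMVChain.zero_ne_one⟩ := rfl

instance : ZeroLEOneClass (ChainGrp C) := ⟨Or.inl Int.zero_lt_one⟩

instance : NeZero (1 : ChainGrp C) := ⟨fun h => one_ne_zero (congrArg ChainGrp.int h)⟩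

theorem nsmul_one (n : ℕ) : n • (1 : ChainGrp C) = ⟨n, 0, IsSimpleMVChain.zero_ne_one⟩ := by
  induction n with
  | zero => rw [zero_nsmul]; rfl
  | succ n ih =>
    rw [succ_nsmul, ih, one_def, add_def,
      add_nocarry (by rw [oplus_zero]; exact IsSimpleMVChain.zero_ne_one)]
    ext
    · change (n : ℤ) + 1 = ((n + 1 : ℕ) : ℤ)
      push_cast
      ring
    · exact oplus_zero _

open Classical in
/-- The chain `C` as the interval `[0, 1]` of its group. -/
noncomputable def emb (x : C) : ChainGrp C :=
  if h : x = 1 then 1 else ⟨0, x, h⟩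

theorem emb_zero : emb (0 : C) = 0 := dif_neg IsSimpleMVChain.zero_ne_one

theorem emb_one : emb (1 : C) = 1 := dif_pos rfl

theorem emb_nonneg (x : C) : 0 ≤ emb x := by
  rw [emb]
  split_ifs
  · exact zero_le_one
  · exact Or.inr ⟨rfl, MVAlgebra.zero_le x⟩

theorem emb_le_one (x : C) : emb x ≤ 1 := by
  rw [emb]
  split_ifs
  · exact _root_.le_refl _
  · exact Or.inl Int.zero_lt_one

theorem emb_injective : Function.Injective (emb : C → ChainGrp C) := by
  intro x y h
  by_cases hx : x = 1 <;> by_cases hy : y = 1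
  · rw [hx, hy]
  · rw [emb, dif_pos hx, emb, dif_neg hy] at h
    exact absurd (congrArg ChainGrp.int h) one_ne_zero
  · rw [emb, dif_neg hx, emb, dif_pos hy] at h
    exact absurd (congrArg ChainGrp.int h) zero_ne_one
  · rw [emb, dif_neg hx, emb, dif_neg hy] at h
    exact congrArg ChainGrp.frac h

theorem emb_oplus (x y : C) : emb (x ⊕ₘ y) = min 1 (emb x + emb y) := by
  by_cases h : x ⊕ₘ y = 1
  · rw [h, emb_one]
    symm
    apply min_eq_left
    by_cases hx : x = 1
    · rw [hx, emb_one]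
      exact le_add_of_nonneg_right (emb_nonneg y)
    · by_cases hy : y = 1
      · rw [hy, emb_one]
        exact le_add_of_nonneg_left (emb_nonneg x)
      · rw [emb, dif_neg hx, emb, dif_neg hy, add_def, add_carry h]
        exact Or.inr ⟨rfl, MVAlgebra.zero_le _⟩
  · have hx : x ≠ 1 := by
      rintro rfl
      exact h (one_oplus y)
    have hy : y ≠ 1 := by
      rintro rfl
      exact h (oplus_one x)
    have e : emb x + emb y = emb (x ⊕ₘ y) := by
      rw [emb, dif_neg hx, emb, dif_neg hy, emb, dif_neg h, add_def, add_nocarry h]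
      rfl
    rw [e, min_eq_right (emb_le_one _)]

theorem emb_star (x : C) : emb x + emb (∼x) = 1 := by
  by_cases hx : x = 1
  · rw [hx, star_top, emb_one, emb_zero, add_zero]
  · by_cases hx0 : x = 0
    · rw [hx0, star_bot, emb_one, emb_zero, zero_add]
    · rw [emb, dif_neg hx, emb, dif_neg (star_ne hx0), add_def, add_carry (oplus_star_self x)]
      ext
      · rfl
      · exact odot_star_self x

theorem emb_nmul_le (n : ℕ) (x : C) : emb (nmul n x) ≤ n • emb x := by
  induction n with
  | zero => rw [nmul, emb_zero, zero_nsmul]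
  | succ n ih =>
    rw [nmul, emb_oplus, succ_nsmul]
    exact (min_le_right _ _).trans (add_le_add_left ih _)

theorem exists_one_le {p : ChainGrp C} (hp : 0 < p) : ∃ n : ℕ, 1 ≤ n • p := by
  obtain ⟨m, x, hx⟩ := p
  by_cases hm : 0 < m
  · refine ⟨1, ?_⟩
    rw [one_nsmul]
    rcases (show (1 : ℤ) ≤ m from hm).lt_or_eq with h | h
    · exact Or.inl h
    · exact Or.inr ⟨h, MVAlgebra.zero_le x⟩
  · have hm0 : m = 0 := by
      rcases hp.le with h | ⟨h, _⟩
      · exact absurd h hm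
      · exact h.symm
    subst hm0
    have hx0 : x ≠ 0 := by
      rintro rfl
      exact lt_irrefl _ hp
    obtain ⟨n, hn⟩ := IsSimpleMVChain.arch x hx0
    refine ⟨n, ?_⟩
    have h := emb_nmul_le n x
    rw [hn, emb_one, emb, dif_neg hx] at h
    exact h

instance : Archimedean (ChainGrp C) where
  arch p q hq := by
    obtain ⟨n, hn⟩ := exists_one_le hq
    refine ⟨(p.int.toNat + 1) * n, ?_⟩
    have h1 : p ≤ (p.int.toNat + 1) • (1 : ChainGrp C) := by
      rw [nsmul_one]
      left
      change p.int < ((p.int.toNat + 1 : ℕ) : ℤ)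
      push_cast
      have := Int.self_le_toNat p.int
      omega
    refine h1.trans ?_
    rw [mul_nsmul']
    exact nsmul_le_nsmul_right hn _

end ChainGrp

/-- A simple MV-chain embeds into `[0, 1]`. -/
theorem IsSimpleMVChain.exists_embedding (C : Type*) [MVAlgebra C] [IsSimpleMVChain C] :
    ∃ f : MVHom C unitInterval, Function.Injective f := by
  let φ := Archimedean.embedReal (ChainGrp C)
  have hφ1 : φ 1 = 1 := Archimedean.embedReal_one
  have hmono : Monotone φ := φ.monotone'
  have h0 : ∀ x : C, 0 ≤ φ (ChainGrp.emb x) := by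
    intro x
    have := hmono (ChainGrp.emb_nonneg x)
    rwa [map_zero] at this
  have h1 : ∀ x : C, φ (ChainGrp.emb x) ≤ 1 := by
    intro x
    have := hmono (ChainGrp.emb_le_one x)
    rwa [hφ1] at this
  refine ⟨⟨fun x => ⟨φ (ChainGrp.emb x), h0 x, h1 x⟩, ?_, ?_, ?_⟩, ?_⟩
  · apply Subtype.ext
    change φ (ChainGrp.emb 0) = 0
    rw [ChainGrp.emb_zero, map_zero]
  · intro x y
    apply Subtype.ext
    change φ (ChainGrp.emb (x ⊕ₘ y)) = min 1 (φ (ChainGrp.emb x) + φ (ChainGrp.emb y))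
    rw [ChainGrp.emb_oplus, hmono.map_min, hφ1, map_add]
  · intro x
    apply Subtype.ext
    change φ (ChainGrp.emb (∼x)) = 1 - φ (ChainGrp.emb x)
    rw [← hφ1, ← ChainGrp.emb_star x, map_add]
    ring
  · intro x y h
    apply ChainGrp.emb_injective
    apply Archimedean.embedReal_injective (ChainGrp C)
    exact congrArg Subtype.val h

theorem unit_val_oplus (x y : unitInterval) : ((x ⊕ₘ y : unitInterval) : ℝ) = min 1 (x + y : ℝ) := rfl

theorem unit_val_star (x : unitInterval) : ((∼x : unitInterval) : ℝ) = 1 - x := rfl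

theorem unit_val_odot (x y : unitInterval) :
    ((x ⊙ₘ y : unitInterval) : ℝ) = max 0 (x + y - 1 : ℝ) := by
  rw [odot, unit_val_star, unit_val_oplus, unit_val_star, unit_val_star, min_def, max_def]
  split_ifs <;> linarith

/-- Two homomorphisms into `[0, 1]` with the same kernel are equal. -/
theorem MVHom.eq_of_ker_eq {A : Type*} [MVAlgebra A] {f g : MVHom A unitInterval}
    (h : ∀ a, f a = 0 ↔ g a = 0) : f = g := by
  have key : ∀ f g : MVHom A unitInterval, (∀ a, f a = 0 ↔ g a = 0) →
      ∀ a, ¬ ((f a : ℝ) < g a) := by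
    intro f g h a ha
    have step : ∀ b, (f b : ℝ) < g b → ∃ c, 2 * ((g b : ℝ) - f b) ≤ (g c : ℝ) - f c := by
      intro b hb
      by_cases h1 : (g b : ℝ) ≤ 1 / 2
      · refine ⟨b ⊕ₘ b, ?_⟩
        rw [f.map_oplus, g.map_oplus, unit_val_oplus, unit_val_oplus,
          min_eq_right (by linarith), min_eq_right (by linarith)]
        linarith
      · by_cases h2 : 1 / 2 ≤ (f b : ℝ)
        · refine ⟨b ⊙ₘ b, ?_⟩
          rw [f.map_odot, g.map_odot, unit_val_odot, unit_val_odot,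
            max_eq_right (by linarith), max_eq_right (by linarith)]
          linarith
        · exfalso
          have h3 : f (b ⊙ₘ b) = 0 := by
            apply Subtype.ext
            rw [f.map_odot, unit_val_odot]
            exact max_eq_left (by linarith)
          have h4 := (h _).1 h3
          have h5 : ((g (b ⊙ₘ b) : unitInterval) : ℝ) = 0 := by rw [h4]; rfl
          rw [g.map_odot, unit_val_odot, max_eq_right (by linarith)] at h5
          linarith
    have iter : ∀ n : ℕ, ∃ c, 2 ^ n * ((g a : ℝ) - f a) ≤ (g c : ℝ) - f c := by
      intro n
      induction n with
      | zero => exact ⟨a, by simp⟩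
      | succ n ih =>
        obtain ⟨c, hc⟩ := ih
        have hpos : 0 < 2 ^ n * ((g a : ℝ) - f a) := by
          have : 0 < (g a : ℝ) - f a := by linarith
          positivity
        obtain ⟨d, hd⟩ := step c (by linarith)
        refine ⟨d, ?_⟩
        rw [pow_succ]
        linarith
    have hδ : 0 < (g a : ℝ) - f a := by linarith
    obtain ⟨n, hn⟩ := pow_unbounded_of_one_lt (1 / ((g a : ℝ) - f a)) (one_lt_two)
    obtain ⟨c, hc⟩ := iter n
    rw [div_lt_iff₀ hδ] at hn
    have h1 := (g c).2.2
    have h2 := (f c).2.1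
    linarith
  apply MVHom.ext
  funext a
  apply Subtype.ext
  exact _root_.le_antisymm (not_lt.1 (key g f (fun a => (h a).symm) a)) (not_lt.1 (key f g h a))

end Chains

/-! ### The maximal spectrum and the fuzzy sets `â` -/

section Spectrum

open MVAlgebra

theorem MVIdeal.IsMaximal.isSimpleMVChain {A : Type*} [MVAlgebra A] {M : MVIdeal A}
    (hM : M.IsMaximal) : IsSimpleMVChain M.Quot where
  zero_ne_one := by
    intro h
    apply (M.isProper_iff.1 hM.1)
    rw [← M.proj_eq_zero_iff, M.proj.map_one]
    exact h.symm
  total := by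
    intro x y
    obtain ⟨a, rfl⟩ := M.proj_surjective x
    obtain ⟨b, rfl⟩ := M.proj_surjective y
    rw [← ominus_eq_zero_iff, ← ominus_eq_zero_iff, ← M.proj.map_ominus, ← M.proj.map_ominus,
      M.proj_eq_zero_iff, M.proj_eq_zero_iff]
    by_cases hu : ominus a b ∈ M
    · exact Or.inl hu
    · right
      obtain ⟨n, hn⟩ := hM.exists_nmul hu
      have h := prelinear a b
      rw [MVAlgebra.inf_comm, odot_eq_zero_iff, star_oplus, star_invol] at h
      have h' : ominus b a ⊙ₘ ∼(ominus a b) = ominus b a :=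
        le_antisymm (odot_le_left _ _) h
      rw [← nmul_odot_star h' n]
      exact M.mem_of_le (odot_le_right _ _) hn
  arch := by
    intro x hx
    obtain ⟨a, rfl⟩ := M.proj_surjective x
    rw [Ne, M.proj_eq_zero_iff] at hx
    obtain ⟨n, hn⟩ := hM.exists_nmul hx
    refine ⟨n, ?_⟩
    rw [← M.proj.map_nmul]
    rw [← M.proj_eq_zero_iff, M.proj.map_star] at hn
    rw [← star_invol (M.proj _), hn, star_bot]

/-- The maximal spectrum `Max A`, i.e. the set of maximal ideals. -/
@[ext]
structure MaxSpec (A : Type*) [MVAlgebra A] where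
  ideal : MVIdeal A
  isMaximal : ideal.IsMaximal

namespace MaxSpec

variable {A : Type*} [MVAlgebra A]

theorem existsUnique_embedding (M : MaxSpec A) :
    ∃! i : MVHom M.ideal.Quot unitInterval, Function.Injective i := by
  have := M.isMaximal.isSimpleMVChain
  obtain ⟨i, hi⟩ := IsSimpleMVChain.exists_embedding M.ideal.Quot
  refine ⟨i, hi, fun j hj => MVHom.eq_of_ker_eq fun a => ?_⟩
  have h1 : i a = 0 ↔ a = 0 := by
    constructor
    · intro h
      exact hi (h.trans i.map_zero.symm)
    · rintro rfl
      exact i.map_zero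
  have h2 : j a = 0 ↔ a = 0 := by
    constructor
    · intro h
      exact hj (h.trans j.map_zero.symm)
    · rintro rfl
      exact j.map_zero
  exact h2.trans h1.symm

/-- The unique embedding of `A / M` into `[0, 1]`. -/
noncomputable def iota (M : MaxSpec A) : MVHom M.ideal.Quot unitInterval :=
  M.existsUnique_embedding.choose

theorem iota_injective (M : MaxSpec A) : Function.Injective M.iota :=
  M.existsUnique_embedding.choose_spec.1

/-- The fuzzy subset `â` of `Max A`: `â(M)` is the value of `a / M` in `[0, 1]`. -/
noncomputable def hat (a : A) : MaxSpec A → unitInterval := fun M => M.iota (M.ideal.proj a)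

/-- The homomorphism `a ↦ â(M)`. -/
noncomputable def eval (M : MaxSpec A) : MVHom A unitInterval := M.iota.comp M.ideal.proj

theorem eval_apply (M : MaxSpec A) (a : A) : M.eval a = hat a M := rfl

theorem eval_eq_zero_iff (M : MaxSpec A) {a : A} : M.eval a = 0 ↔ a ∈ M.ideal := by
  rw [← M.ideal.proj_eq_zero_iff, ← M.iota_injective.eq_iff, M.iota.map_zero]
  rfl

/-- The homomorphism `a ↦ â` from `A` to `[0, 1] ^ Max A`. -/
noncomputable def hatHom (A : Type*) [MVAlgebra A] : MVHom A (MaxSpec A → unitInterval) where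
  toFun := hat
  map_zero' := funext fun M => M.eval.map_zero
  map_oplus' x y := funext fun M => M.eval.map_oplus x y
  map_star' x := funext fun M => M.eval.map_star x

theorem hat_zero : hat (0 : A) = 0 := (hatHom A).map_zero

theorem hat_one : hat (1 : A) = 1 := (hatHom A).map_one

theorem hat_oplus (a b : A) : hat (a ⊕ₘ b) = hat a ⊕ₘ hat b := (hatHom A).map_oplus a b

theorem hat_star (a : A) : hat (∼a) = ∼(hat a) := (hatHom A).map_star a

theorem hat_odot (a b : A) : hat (a ⊙ₘ b) = hat a ⊙ₘ hat b := (hatHom A).map_odot a b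

theorem unit_inf (x y : unitInterval) : x ⊙ₘ (∼x ⊕ₘ y) = x ⊓ y := by
  apply Subtype.ext
  rw [unit_val_odot, unit_val_oplus, unit_val_star]
  change _ = min (x : ℝ) y
  have hx0 := x.2.1
  have hx1 := x.2.2
  have hy0 := y.2.1
  have hy1 := y.2.2
  simp only [min_def, max_def]
  split_ifs <;> linarith

theorem hat_inf (a b : A) : hat (a ⊙ₘ (∼a ⊕ₘ b)) = hat a ⊓ hat b := by
  rw [hat_odot, hat_oplus, hat_star]
  exact funext fun M => unit_inf _ _

theorem unit_exists_nmul {x : unitInterval} (hx : x ≠ 0) : ∃ n, nmul n x = 1 := by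
  have hpos : 0 < (x : ℝ) := unitInterval.pos_iff_ne_zero.2 hx
  have h : ∀ n : ℕ, ((nmul n x : unitInterval) : ℝ) = min 1 (n * x : ℝ) := by
    intro n
    induction n with
    | zero => simp [nmul]
    | succ n ih =>
      rw [nmul, unit_val_oplus, ih]
      push_cast
      simp only [min_def]
      split_ifs <;> linarith
  obtain ⟨n, hn⟩ := exists_nat_gt (1 / (x : ℝ))
  rw [div_lt_iff₀ hpos] at hn
  exact ⟨n, Subtype.ext (by rw [h, min_eq_left hn.le]; rfl)⟩

theorem ker_isMaximal (f : MVHom A unitInterval) : (MVIdeal.ker f).IsMaximal := by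
  constructor
  · rw [MVIdeal.isProper_iff]
    intro h
    have h1 : f 1 = 0 := h
    rw [f.map_one] at h1
    exact one_ne_zero h1
  · intro J hJ hle
    refine Set.Subset.antisymm (fun a ha => ?_) hle
    by_contra hfa
    obtain ⟨n, hn⟩ := unit_exists_nmul (x := f a) hfa
    rw [MVIdeal.isProper_iff] at hJ
    apply hJ
    rw [← oplus_star_self (nmul n a)]
    refine J.oplus_mem (J.nmul_mem ha n) (hle ?_)
    change f _ = 0
    rw [f.map_star, f.map_nmul, hn, star_top]

theorem comap_isMaximal {B : Type*} [MVAlgebra B] (h : MVHom A B) (N : MaxSpec B) :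
    (MVIdeal.comap h N.ideal).IsMaximal := by
  have e : MVIdeal.comap h N.ideal = MVIdeal.ker (N.eval.comp h) := by
    ext a
    exact N.eval_eq_zero_iff.symm
  rw [e]
  exact ker_isMaximal _

/-- The map `Max h : Max B → Max A`, `N ↦ h⁻¹(N)`. -/
def comap {B : Type*} [MVAlgebra B] (h : MVHom A B) (N : MaxSpec B) : MaxSpec A :=
  ⟨MVIdeal.comap h N.ideal, comap_isMaximal h N⟩

theorem hat_comp_comap {B : Type*} [MVAlgebra B] (h : MVHom A B) (a : A) :
    hat a ∘ comap h = hat (h a) := by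
  funext N
  have e : (comap h N).eval = N.eval.comp h := by
    apply MVHom.eq_of_ker_eq
    intro b
    rw [eval_eq_zero_iff]
    exact N.eval_eq_zero_iff.symm
  exact congrArg (fun f : MVHom A unitInterval => f a) e

end MaxSpec

end Spectrum

/-! ### MV-topologies -/

/-- An MV-topology on a set `X`: a family of fuzzy subsets containing `0` and `1` and closed under
arbitrary joins and under `⊙`, `⊕`, `∧`. -/
structure MVTopology (X : Type*) where
  opens : Set (X → unitInterval)
  zero_mem : 0 ∈ opens
  one_mem : 1 ∈ opens
  sSup_mem : ∀ S ⊆ opens, sSup S ∈ opens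
  odot_mem : ∀ o ∈ opens, ∀ o' ∈ opens, o ⊙ₘ o' ∈ opens
  oplus_mem : ∀ o ∈ opens, ∀ o' ∈ opens, o ⊕ₘ o' ∈ opens
  inf_mem : ∀ o ∈ opens, ∀ o' ∈ opens, o ⊓ o' ∈ opens

namespace MVTopology

variable {X Y Z : Type*}

/-- The closed fuzzy subsets `o*`, with `o` open. -/
def closeds (Ω : MVTopology X) : Set (X → unitInterval) := {c | ∃ o ∈ Ω.opens, c = ∼o}

/-- The clopen fuzzy subsets. -/
def clopens (Ω : MVTopology X) : Set (X → unitInterval) := Ω.opens ∩ Ω.closeds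

theorem mem_closeds_iff (Ω : MVTopology X) {c : X → unitInterval} :
    c ∈ Ω.closeds ↔ ∼c ∈ Ω.opens := by
  constructor
  · rintro ⟨o, ho, rfl⟩
    rwa [MVAlgebra.star_invol]
  · intro h
    exact ⟨∼c, h, (MVAlgebra.star_invol c).symm⟩

/-- The set of clopen fuzzy subsets as a type. -/
@[ext]
structure Clop (Ω : MVTopology X) where
  val : X → unitInterval
  property : val ∈ Ω.clopens

theorem zero_mem_clopens (Ω : MVTopology X) : 0 ∈ Ω.clopens :=
  ⟨Ω.zero_mem, 1, Ω.one_mem, MVAlgebra.star_top.symm⟩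

theorem one_mem_clopens (Ω : MVTopology X) : 1 ∈ Ω.clopens :=
  ⟨Ω.one_mem, 0, Ω.zero_mem, MVAlgebra.star_bot.symm⟩

theorem oplus_mem_clopens (Ω : MVTopology X) {o o' : X → unitInterval} (h : o ∈ Ω.clopens)
    (h' : o' ∈ Ω.clopens) : o ⊕ₘ o' ∈ Ω.clopens := by
  refine ⟨Ω.oplus_mem _ h.1 _ h'.1, ?_⟩
  rw [mem_closeds_iff, MVAlgebra.star_oplus]
  exact Ω.odot_mem _ (Ω.mem_closeds_iff.1 h.2) _ (Ω.mem_closeds_iff.1 h'.2)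

theorem star_mem_clopens (Ω : MVTopology X) {o : X → unitInterval} (h : o ∈ Ω.clopens) :
    ∼o ∈ Ω.clopens :=
  ⟨Ω.mem_closeds_iff.1 h.2, o, h.1, rfl⟩

/-- `Clop` as a subalgebra of `[0, 1]^X`. -/
noncomputable instance (Ω : MVTopology X) : MVAlgebra Ω.Clop where
  zero := ⟨0, Ω.zero_mem_clopens⟩
  one := ⟨1, Ω.one_mem_clopens⟩
  oplus o o' := ⟨o.1 ⊕ₘ o'.1, Ω.oplus_mem_clopens o.2 o'.2⟩
  star o := ⟨∼o.1, Ω.star_mem_clopens o.2⟩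
  oplus_assoc _ _ _ := Clop.ext (MVAlgebra.oplus_assoc _ _ _)
  oplus_comm _ _ := Clop.ext (MVAlgebra.oplus_comm _ _)
  oplus_zero _ := Clop.ext (MVAlgebra.oplus_zero _)
  star_invol _ := Clop.ext (MVAlgebra.star_invol _)
  one_eq := Clop.ext MVAlgebra.one_eq
  oplus_one _ := Clop.ext (MVAlgebra.oplus_one _)
  luk _ _ := Clop.ext (MVAlgebra.luk _ _)

/-- MV-continuity: preimages `o ∘ f` of open fuzzy subsets are open. -/
def Continuous (Ω : MVTopology X) (Ω' : MVTopology Y) (f : X → Y) : Prop :=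
  ∀ o ∈ Ω'.opens, o ∘ f ∈ Ω.opens

/-- MV-homeomorphisms: bijections that are continuous together with their inverses. -/
def IsHomeo (Ω : MVTopology X) (Ω' : MVTopology Y) (e : X ≃ Y) : Prop :=
  Continuous Ω Ω' e ∧ Continuous Ω' Ω e.symm

theorem comp_mem_clopens {Ω : MVTopology X} {Ω' : MVTopology Y} {f : X → Y}
    (hf : Continuous Ω Ω' f) {o : Y → unitInterval} (ho : o ∈ Ω'.clopens) :
    o ∘ f ∈ Ω.clopens := by
  refine ⟨hf _ ho.1, ?_⟩
  obtain ⟨p, hp, rfl⟩ := ho.2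
  exact ⟨p ∘ f, hf _ hp, rfl⟩

/-- The homomorphism `Clop f : Clop Ω' → Clop Ω`, `o ↦ o ∘ f`. -/
def clopMap {Ω : MVTopology X} {Ω' : MVTopology Y} {f : X → Y} (hf : Continuous Ω Ω' f) :
    MVHom Ω'.Clop Ω.Clop where
  toFun o := ⟨o.1 ∘ f, comp_mem_clopens hf o.2⟩
  map_zero' := rfl
  map_oplus' _ _ := rfl
  map_star' _ := rfl

/-- A base: a family of open fuzzy subsets such that every open one is a join of members. -/
def IsBase (Ω : MVTopology X) (Θ : Set (X → unitInterval)) : Prop :=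
  Θ ⊆ Ω.opens ∧ ∀ o ∈ Ω.opens, ∃ G ⊆ Θ, o = sSup G

/-- Compactness: every open covering contains an additive covering (a finite family, possibly with
repetitions, whose `⊕`-sum is `1`). -/
def IsCompact (Ω : MVTopology X) : Prop :=
  ∀ Γ ⊆ Ω.opens, sSup Γ = 1 →
    ∃ l : List (X → unitInterval), (∀ o ∈ l, o ∈ Γ) ∧ MVAlgebra.sumList l = 1

/-- The Hausdorff separation axiom. -/
def IsHausdorff (Ω : MVTopology X) : Prop :=
  ∀ x y : X, x ≠ y → ∃ o ∈ Ω.opens, ∃ o' ∈ Ω.opens, o x = 1 ∧ o' y = 1 ∧ o ⊓ o' = 0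

/-- Zero-dimensionality: there is a base of clopen fuzzy subsets. -/
def IsZeroDimensional (Ω : MVTopology X) : Prop := ∃ Θ ⊆ Ω.clopens, Ω.IsBase Θ

/-- Stone MV-spaces. -/
def IsStone (Ω : MVTopology X) : Prop := Ω.IsCompact ∧ Ω.IsHausdorff ∧ Ω.IsZeroDimensional

end MVTopology

/-! ### The MV-topology of the maximal spectrum -/

namespace MaxSpec

section

open MVAlgebra

variable {A : Type*} [MVAlgebra A]

/-- The joins of families of fuzzy sets `â`. -/
def specOpens (A : Type*) [MVAlgebra A] : Set (MaxSpec A → unitInterval) :=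
  {o | ∃ G ⊆ Set.range (hat (A := A)), o = sSup G}

theorem hat_mem_specOpens (a : A) : hat a ∈ specOpens A :=
  ⟨{hat a}, by rintro _ rfl; exact ⟨a, rfl⟩, sSup_singleton.symm⟩

theorem exists_lt_of_sSup {X : Type*} {S : Set (X → unitInterval)} {x : X} {r : ℝ}
    (hr : 0 ≤ r) (h : r < (sSup S x : unitInterval)) : ∃ s ∈ S, r < (s x : unitInterval) := by
  have h1 : (⟨r, hr, h.le.trans (sSup S x).2.2⟩ : unitInterval) < sSup S x := h
  have h3 := lt_of_lt_of_eq h1 (sSup_apply (s := S) (a := x))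
  rw [lt_iSup_iff] at h3
  obtain ⟨⟨s, hs⟩, h2⟩ := h3
  exact ⟨s, hs, h2⟩

theorem mem_specOpens_iff {o : MaxSpec A → unitInterval} :
    o ∈ specOpens A ↔
      ∀ M, ∀ ε : ℝ, 0 < ε → ∃ a : A, hat a ≤ o ∧ (o M : ℝ) - ε < (hat a M : unitInterval) := by
  constructor
  · rintro ⟨G, hG, rfl⟩ M ε hε
    by_cases h : (0 : ℝ) ≤ (sSup G M : unitInterval) - ε
    · obtain ⟨s, hs, h1⟩ := exists_lt_of_sSup h (sub_lt_self _ hε)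
      obtain ⟨a, rfl⟩ := hG hs
      exact ⟨a, le_sSup hs, h1⟩
    · refine ⟨0, ?_, ?_⟩
      · rw [hat_zero]
        exact fun M => unitInterval.nonneg' (t := _)
      · rw [hat_zero]
        exact not_le.1 h
  · intro h
    refine ⟨{g | g ∈ Set.range (hat (A := A)) ∧ g ≤ o}, fun g hg => hg.1, ?_⟩
    apply _root_.le_antisymm
    · intro M
      change (o M : ℝ) ≤ _
      apply le_of_forall_pos_lt_add
      intro ε hε
      obtain ⟨a, ha, h1⟩ := h M ε hε
      have h2 : hat a ≤ sSup {g | g ∈ Set.range (hat (A := A)) ∧ g ≤ o} := le_sSup ⟨⟨a, rfl⟩, ha⟩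
      have h3 : ((hat a M : unitInterval) : ℝ) ≤ _ := h2 M
      linarith
    · exact sSup_le fun g hg => hg.2

/-- The MV-topology on `Max A` having the fuzzy sets `â` as a base. -/
noncomputable def topology (A : Type*) [MVAlgebra A] : MVTopology (MaxSpec A) where
  opens := specOpens A
  zero_mem := by
    rw [← hat_zero]
    exact hat_mem_specOpens 0
  one_mem := by
    rw [← hat_one]
    exact hat_mem_specOpens 1
  sSup_mem S hS := by
    rw [mem_specOpens_iff]
    intro M ε hε
    by_cases h : (0 : ℝ) ≤ (sSup S M : unitInterval) - ε / 2
    · obtain ⟨s, hs, h1⟩ := exists_lt_of_sSup h (sub_lt_self _ (half_pos hε))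
      obtain ⟨a, ha, h2⟩ := mem_specOpens_iff.1 (hS hs) M (ε / 2) (half_pos hε)
      exact ⟨a, ha.trans (le_sSup hs), by linarith⟩
    · refine ⟨0, ?_, ?_⟩
      · rw [hat_zero]
        exact fun M => unitInterval.nonneg' (t := _)
      · rw [hat_zero]
        change _ < (0 : ℝ)
        linarith [not_le.1 h]
  odot_mem o ho p hp := by
    rw [mem_specOpens_iff] at *
    intro M ε hε
    obtain ⟨a, ha, h1⟩ := ho M (ε / 2) (half_pos hε)
    obtain ⟨b, hb, h2⟩ := hp M (ε / 2) (half_pos hε)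
    refine ⟨a ⊙ₘ b, ?_, ?_⟩
    · rw [hat_odot]
      intro N
      change ((hat a N ⊙ₘ hat b N : unitInterval) : ℝ) ≤ (o N ⊙ₘ p N : unitInterval)
      rw [unit_val_odot, unit_val_odot]
      have h3 : ((hat a N : unitInterval) : ℝ) ≤ o N := ha N
      have h4 : ((hat b N : unitInterval) : ℝ) ≤ p N := hb N
      exact max_le_max _root_.le_rfl (by linarith)
    · rw [hat_odot]
      change ((o M ⊙ₘ p M : unitInterval) : ℝ) - ε < (hat a M ⊙ₘ hat b M : unitInterval)
      rw [unit_val_odot, unit_val_odot]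
      simp only [max_def]
      split_ifs <;> linarith
  oplus_mem o ho p hp := by
    rw [mem_specOpens_iff] at *
    intro M ε hε
    obtain ⟨a, ha, h1⟩ := ho M (ε / 2) (half_pos hε)
    obtain ⟨b, hb, h2⟩ := hp M (ε / 2) (half_pos hε)
    refine ⟨a ⊕ₘ b, ?_, ?_⟩
    · rw [hat_oplus]
      intro N
      change ((hat a N ⊕ₘ hat b N : unitInterval) : ℝ) ≤ (o N ⊕ₘ p N : unitInterval)
      rw [unit_val_oplus, unit_val_oplus]
      have h3 : ((hat a N : unitInterval) : ℝ) ≤ o N := ha N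
      have h4 : ((hat b N : unitInterval) : ℝ) ≤ p N := hb N
      exact min_le_min _root_.le_rfl (by linarith)
    · rw [hat_oplus]
      change ((o M ⊕ₘ p M : unitInterval) : ℝ) - ε < (hat a M ⊕ₘ hat b M : unitInterval)
      rw [unit_val_oplus, unit_val_oplus]
      simp only [min_def]
      split_ifs <;> linarith
  inf_mem o ho p hp := by
    rw [mem_specOpens_iff] at *
    intro M ε hε
    obtain ⟨a, ha, h1⟩ := ho M ε hε
    obtain ⟨b, hb, h2⟩ := hp M ε hε
    refine ⟨a ⊙ₘ (∼a ⊕ₘ b), ?_, ?_⟩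
    · rw [hat_inf]
      exact inf_le_inf ha hb
    · rw [hat_inf]
      change min (o M : ℝ) (p M) - ε < min ((hat a M : unitInterval) : ℝ) (hat b M : unitInterval)
      rw [lt_min_iff]
      exact ⟨by linarith [min_le_left (o M : ℝ) (p M)], by linarith [min_le_right (o M : ℝ) (p M)]⟩

theorem continuous_comap {B : Type*} [MVAlgebra B] (h : MVHom A B) :
    MVTopology.Continuous (topology B) (topology A) (comap h) := by
  intro o ho
  change _ ∈ specOpens B
  have ho' : o ∈ specOpens A := ho
  rw [mem_specOpens_iff] at *
  intro N ε hε
  obtain ⟨a, ha, h1⟩ := ho' (comap h N) ε hε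
  refine ⟨h a, ?_, ?_⟩
  · rw [← hat_comp_comap]
    exact fun N => ha _
  · rw [← hat_comp_comap]
    exact h1

end

end MaxSpec

/-! ### Semisimple and limit cut complete algebras -/

/-- Simple algebras: `{0}` is the only proper ideal. -/
def MVAlgebra.IsSimple (A : Type*) [MVAlgebra A] : Prop :=
  ∀ I : MVIdeal A, I.IsProper ↔ I.carrier = {0}

/-- Semisimple algebras: subdirect products of simple algebras. -/
def MVAlgebra.IsSemisimple (A : Type u) [MVAlgebra A] : Prop :=
  ∃ (J : Type u) (B : J → Type u) (_ : ∀ j, MVAlgebra (B j)) (f : MVHom A (∀ j, B j)),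
    (∀ j, MVAlgebra.IsSimple (B j)) ∧ Function.Injective f ∧
      ∀ j, Function.Surjective fun a => f a j

section Cuts

variable {A : Type*} [MVAlgebra A]

/-- The set `u X` of upper bounds. -/
def MVAlgebra.upper (X : Set A) : Set A := {b | ∀ a ∈ X, a ≤ₘ b}

/-- The set `l X` of lower bounds. -/
def MVAlgebra.lower (X : Set A) : Set A := {b | ∀ a ∈ X, b ≤ₘ a}

/-- Cuts: subsets with `X = l u X`. -/
def MVAlgebra.IsCut (X : Set A) : Prop := X = lower (upper X)

/-- Limit cuts: cuts `X` such that the meet of all the fuzzy sets `d(â, b̂)`, with `a ∈ X` and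
`b ∈ u X`, is `0` in `[0, 1] ^ Max A`. -/
def MVAlgebra.IsLimitCut (X : Set A) : Prop :=
  IsCut X ∧ sInf {δ : MaxSpec A → unitInterval | ∃ a ∈ X, ∃ b ∈ upper X,
    δ = mvdist (MaxSpec.hat a) (MaxSpec.hat b)} = 0

end Cuts

/-- Limit cut complete algebras: semisimple algebras in which every limit cut has a supremum. -/
def MVAlgebra.IsLimitCutComplete (A : Type u) [MVAlgebra A] : Prop :=
  MVAlgebra.IsSemisimple A ∧
    ∀ X : Set A, IsLimitCut X → ∃ s ∈ upper X, ∀ b ∈ upper X, s ≤ₘ b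

/-! ### The categories and the functors -/

/-- Objects of the category of MV-algebras. -/
structure MVAlg : Type (u + 1) where
  carrier : Type u
  [str : MVAlgebra carrier]

attribute [instance] MVAlg.str

instance : Category MVAlg.{u} where
  Hom A B := MVHom A.carrier B.carrier
  id A := MVHom.id A.carrier
  comp f g := MVHom.comp g f

/-- Objects of the category of MV-topological spaces. -/
structure MVTop : Type (u + 1) where
  carrier : Type u
  topology : MVTopology carrier

instance : Category MVTop.{u} where
  Hom τ τ' := {f : τ.carrier → τ'.carrier // MVTopology.Continuous τ.topology τ'.topology f}
  id _ := ⟨fun x => x, fun _ ho => ho⟩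
  comp f g := ⟨fun x => g.1 (f.1 x), fun o ho => f.2 _ (g.2 o ho)⟩

/-- The contravariant functor `Clop`. -/
noncomputable def clopFunctor : MVTop.{u}ᵒᵖ ⥤ MVAlg.{u} where
  obj τ := ⟨τ.unop.topology.Clop⟩
  map f := MVTopology.clopMap f.unop.2

/-- The contravariant functor `Max`. -/
noncomputable def maxFunctor : MVAlg.{u}ᵒᵖ ⥤ MVTop.{u} where
  obj A := ⟨MaxSpec A.unop.carrier, MaxSpec.topology A.unop.carrier⟩
  map h := ⟨MaxSpec.comap h.unop, MaxSpec.continuous_comap h.unop⟩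

/-- Limit cut completeness as a property of objects. -/
def isLcc : ObjectProperty MVAlg.{u} := fun A => MVAlgebra.IsLimitCutComplete A.carrier

/-- Being a Stone MV-space as a property of objects. -/
def isStoneMV : ObjectProperty MVTop.{u} := fun τ => τ.topology.IsStone

/-- The full subcategory of limit cut complete MV-algebras. -/
abbrev LccMVAlg : Type (u + 1) := (isLcc.{u}).FullSubcategory

/-- The full subcategory of Stone MV-spaces. -/
abbrev StoneMVTop : Type (u + 1) := (isStoneMV.{u}).FullSubcategory

/-! The duality is carried by two evaluation maps: `a ↦ â` from `A` to `Clop (Max A)`, and `x ↦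
M_x`, the ideal of clopens vanishing at `x`, from a space to `Max (Clop Ω)`. A homomorphism into
`[0, 1]` is determined by its kernel (`MVHom.eq_of_ker_eq`), so `ĉ(M_x) = c(x)` (`hat_toMaxSpec`);
both maps are therefore controlled by values at points.

Limit cuts describe clopenness order-theoretically. A clopen `o` on `Max A` is a join of fuzzy sets
`â` because it is open, and a meet of fuzzy sets `b̂` because it is closed. Hence `{a | â ≤ o}` is a
limit cut whose upper bounds are the `b` with `o ≤ b̂`, and the hat of its supremum is squeezed onto
`o`. Together with injectivity of `a ↦ â` on semisimple algebras this gives `hatClop_bijective`.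
Conversely, for a limit cut of `Clop Ω` the pointwise join of its members equals the pointwise meet
of its upper bounds; being a join of opens and a meet of closed sets, it is clopen, and it is the
supremum (`isLimitCutComplete_clop`).

On the side of spaces, `Max A` is compact because a proper ideal lies in a maximal one, and
Hausdorff because an element of `M` outside `N` has a multiple whose hat is `1` at `N` and still `0`
at `M`. In a Stone MV-space, separation by clopens makes `x ↦ M_x` injective, and compactness forces
every maximal ideal of clopens to have a common zero (`IsStone.toMaxSpec_bijective`). The map is a
homeomorphism because it matches the base of clopens `c` with the base of fuzzy sets `ĉ`. -/

namespace MVAlgebra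

/-! ### Order and distance in `[0, 1]` and in its powers. -/

theorem unit_le_iff {x y : unitInterval} : x ≤ₘ y ↔ x ≤ y := by
  rw [le, Subtype.ext_iff, unit_val_oplus, unit_val_star]
  change min (1 : ℝ) _ = 1 ↔ (x : ℝ) ≤ y
  rw [min_eq_left_iff]
  constructor <;> intro h <;> linarith

theorem fuzzy_le_iff {X : Type*} {f g : X → unitInterval} : f ≤ₘ g ↔ f ≤ g := by
  constructor
  · intro h x
    exact unit_le_iff.1 (congrFun h x)
  · intro h
    exact funext fun x => unit_le_iff.2 (h x)

theorem fuzzy_star_le_comm {X : Type*} {f g : X → unitInterval} (h : f ≤ ∼g) : g ≤ ∼f := by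
  rw [← fuzzy_le_iff] at h ⊢
  have := star_le_star h
  rwa [star_invol] at this

/-- The square `x ⊙ x = max (0, 2x - 1)` is nonzero only for `x > 1/2`, and the square of `x*` only
for `x < 1/2`. Squaring thus turns a fuzzy set and its complement into disjoint ones while keeping
the value `1`, as the Hausdorff axiom needs. -/
theorem unit_odot_self_inf (x : unitInterval) : (x ⊙ₘ x) ⊓ (∼x ⊙ₘ ∼x) = 0 := by
  apply Subtype.ext
  change min ((x ⊙ₘ x : unitInterval) : ℝ) (∼x ⊙ₘ ∼x : unitInterval) = 0
  rw [unit_val_odot, unit_val_odot, unit_val_star]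
  simp only [min_def, max_def]
  split_ifs <;> linarith

/-- Chang's distance in `[0, 1]` between comparable elements is the difference. -/
theorem unit_val_mvdist_of_le {x y : unitInterval} (h : x ≤ y) :
    ((mvdist x y : unitInterval) : ℝ) = y - x := by
  have h' : (x : ℝ) ≤ y := h
  rw [mvdist, ominus_eq_zero_iff.2 (unit_le_iff.2 h), zero_oplus, ominus, unit_val_odot,
    unit_val_star, max_eq_right] <;> linarith

theorem sumList_append {A : Type*} [MVAlgebra A] (l l' : List A) :
    sumList (l ++ l') = sumList l ⊕ₘ sumList l' := by
  induction l with
  | nil => exact (zero_oplus _).symm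
  | cons a l ih =>
    change a ⊕ₘ sumList (l ++ l') = a ⊕ₘ sumList l ⊕ₘ sumList l'
    rw [ih, oplus_assoc]

end MVAlgebra

open MVAlgebra

/-! ### Generated ideals and existence of maximal ideals. -/

namespace MVIdeal

variable {A : Type*} [MVAlgebra A]

/-- The ideal generated by a set. -/
def span (G : Set A) : MVIdeal A where
  carrier := {x | ∃ l : List A, (∀ a ∈ l, a ∈ G) ∧ x ≤ₘ sumList l}
  zero_mem' := ⟨[], by simp, zero_le _⟩
  oplus_mem' := by
    rintro x ⟨l, hl, hx⟩ y ⟨l', hl', hy⟩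
    refine ⟨l ++ l', fun a ha => ?_, ?_⟩
    · rcases List.mem_append.1 ha with h | h
      exacts [hl a h, hl' a h]
    · rw [sumList_append]
      exact oplus_le_oplus hx hy
  mem_of_le' := fun _ _ hxy ⟨l, hl, hy⟩ => ⟨l, hl, MVAlgebra.le_trans hxy hy⟩

theorem subset_span (G : Set A) : G ⊆ (span G).carrier := by
  intro a ha
  refine ⟨[a], by simpa using ha, ?_⟩
  change a ≤ₘ a ⊕ₘ 0
  rw [oplus_zero]
  exact MVAlgebra.le_refl a

/-- Zorn's lemma: properness means that `1` is not a member, and this passes to unions of chains. -/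
theorem IsProper.exists_le_maximal {I : MVIdeal A} (hI : I.IsProper) :
    ∃ M : MVIdeal A, M.IsMaximal ∧ I.carrier ⊆ M.carrier := by
  obtain ⟨m, hIm, hm⟩ := zorn_subset_nonempty
    {s : Set A | ∃ J : MVIdeal A, J.IsProper ∧ J.carrier = s} (by
      intro c hc hchain hne
      refine ⟨⋃₀ c, ⟨⟨⋃₀ c, ?_, ?_, ?_⟩, ?_, rfl⟩, fun s hs => Set.subset_sUnion_of_mem hs⟩
      · obtain ⟨s, hs⟩ := hne
        obtain ⟨J, -, rfl⟩ := hc hs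
        exact ⟨_, hs, J.zero_mem⟩
      · rintro x ⟨s, hs, hx⟩ y ⟨t, ht, hy⟩
        rcases hchain.total hs ht with h | h
        · obtain ⟨J, -, rfl⟩ := hc ht
          exact ⟨_, ht, J.oplus_mem' _ (h hx) _ hy⟩
        · obtain ⟨J, -, rfl⟩ := hc hs
          exact ⟨_, hs, J.oplus_mem' _ hx _ (h hy)⟩
      · rintro x y hxy ⟨s, hs, hy⟩
        obtain ⟨J, -, rfl⟩ := hc hs
        exact ⟨_, hs, J.mem_of_le' _ _ hxy hy⟩
      · rw [isProper_iff]
        rintro ⟨s, hs, h1⟩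
        obtain ⟨J, hJ, rfl⟩ := hc hs
        exact J.isProper_iff.1 hJ h1)
    I.carrier ⟨I, hI, rfl⟩
  obtain ⟨M, hM, rfl⟩ := hm.prop
  exact ⟨M, ⟨hM, fun J hJ h => (hm.eq_of_subset ⟨J, hJ, rfl⟩ h).symm⟩, hIm⟩

theorem IsMaximal.eq_of_le {I J : MVIdeal A} (hI : I.IsMaximal) (hJ : J.IsProper)
    (h : I.carrier ⊆ J.carrier) : I = J :=
  MVIdeal.ext (hI.2 J hJ h).symm

end MVIdeal

/-! ### The maximal spectrum is a Stone MV-space. -/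

namespace MaxSpec

variable {A : Type*} [MVAlgebra A]

theorem hat_le_hat {a b : A} (h : a ≤ₘ b) : hat a ≤ hat b :=
  fuzzy_le_iff.1 ((hatHom A).map_le h)

/-- The order is an equation, `a* ⊕ b = 1`, so an injective homomorphism reflects it. -/
theorem le_of_hat_le (hinj : Function.Injective (hat (A := A))) {a b : A} (h : hat a ≤ hat b) :
    a ≤ₘ b := by
  apply hinj
  rw [hat_oplus, hat_star, hat_one]
  exact fuzzy_le_iff.2 h

/-- Consider the ideal generated by the `a` with `â` below some member of the cover. If it were
proper, all these `â` would vanish at a common maximal ideal, although the cover has value `1`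
there. So `1` is a finite sum of such `a`, and enlarging each summand to a member of the cover
yields the additive covering. -/
theorem isCompact_topology (A : Type*) [MVAlgebra A] : (topology A).IsCompact := by
  intro Γ hΓ hsup
  have h1 : ¬ (MVIdeal.span {a : A | ∃ o ∈ Γ, hat a ≤ o}).IsProper := by
    intro h
    obtain ⟨M, hM, hle⟩ := h.exists_le_maximal
    let N : MaxSpec A := ⟨M, hM⟩
    have h2 : (0 : ℝ) < (sSup Γ N : unitInterval) := by
      rw [hsup]
      exact one_pos
    obtain ⟨o, ho, h3⟩ := exists_lt_of_sSup _root_.le_rfl h2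
    have ho' : o ∈ specOpens A := hΓ ho
    -- The tolerance is `o N` itself, so the basic fuzzy set `â` is still positive at `N`.
    obtain ⟨a, ha, h4⟩ := mem_specOpens_iff.1 ho' N _ h3
    rw [sub_self] at h4
    have h5 : N.eval a = 0 := N.eval_eq_zero_iff.2 (hle (MVIdeal.subset_span _ ⟨o, ho, ha⟩))
    rw [← eval_apply, h5] at h4
    exact lt_irrefl _ h4
  rw [MVIdeal.isProper_iff, not_not] at h1
  obtain ⟨l, hl, hle⟩ := h1
  -- One member of `Γ` is chosen for each summand; the same member may be chosen several times,
  -- which additive coverings permit.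
  have key : ∀ l : List A, (∀ a ∈ l, ∃ o ∈ Γ, hat a ≤ o) →
      ∃ l' : List (MaxSpec A → unitInterval), (∀ o ∈ l', o ∈ Γ) ∧ hat (sumList l) ≤ₘ sumList l' := by
    intro l
    induction l with
    | nil => exact fun _ => ⟨[], by simp, by rw [sumList, List.foldr_nil, hat_zero]; exact zero_le _⟩
    | cons a l ih =>
      intro h
      obtain ⟨l', hl', hle⟩ := ih fun b hb => h b (List.mem_cons_of_mem _ hb)
      obtain ⟨o, ho, hao⟩ := h a List.mem_cons_self
      refine ⟨o :: l', by simpa using ⟨ho, hl'⟩, ?_⟩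
      change hat (a ⊕ₘ sumList l) ≤ₘ o ⊕ₘ sumList l'
      rw [hat_oplus]
      exact oplus_le_oplus (fuzzy_le_iff.2 hao) hle
  obtain ⟨l', hl', hle'⟩ := key l hl
  refine ⟨l', hl', MVAlgebra.one_le (MVAlgebra.le_trans ?_ hle')⟩
  rw [MVAlgebra.one_le hle, hat_one]
  exact MVAlgebra.le_refl _

/-- Distinct maximal ideals are not nested, so some `a` lies in `M` but not in `N`. Since `[0, 1]`
is archimedean, a multiple of the positive number `â(N)` reaches `1`, while all multiples of `a`
stay in `M`. -/
theorem exists_hat_eq_one_of_ne {M N : MaxSpec A} (h : M ≠ N) :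
    ∃ c : A, hat c M = 0 ∧ hat c N = 1 := by
  have h1 : ¬ M.ideal.carrier ⊆ N.ideal.carrier := fun hle =>
    h (MaxSpec.ext (M.isMaximal.eq_of_le N.isMaximal.1 hle))
  obtain ⟨a, haM, haN⟩ := Set.not_subset.1 h1
  obtain ⟨n, hn⟩ := unit_exists_nmul (x := N.eval a) fun h0 => haN (N.eval_eq_zero_iff.1 h0)
  refine ⟨nmul n a, M.eval_eq_zero_iff.2 (M.ideal.nmul_mem haM n), ?_⟩
  rw [← eval_apply, MVHom.map_nmul, hn]

theorem isHausdorff_topology (A : Type*) [MVAlgebra A] : (topology A).IsHausdorff := by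
  intro M N hMN
  obtain ⟨c, hM, hN⟩ := exists_hat_eq_one_of_ne hMN
  refine ⟨hat (∼c ⊙ₘ ∼c), hat_mem_specOpens _, hat (c ⊙ₘ c), hat_mem_specOpens _, ?_, ?_, ?_⟩
  · rw [hat_odot, hat_star]
    change ∼(hat c M) ⊙ₘ ∼(hat c M) = 1
    rw [hM, star_bot, odot_one]
  · rw [hat_odot]
    change hat c N ⊙ₘ hat c N = 1
    rw [hN, odot_one]
  · rw [_root_.inf_comm, hat_odot, hat_odot, hat_star]
    exact funext fun P => unit_odot_self_inf (hat c P)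

theorem hat_mem_clopens (a : A) : hat a ∈ (topology A).clopens := by
  refine ⟨hat_mem_specOpens a, (topology A).mem_closeds_iff.2 ?_⟩
  rw [← hat_star]
  exact hat_mem_specOpens _

theorem isZeroDimensional_topology (A : Type*) [MVAlgebra A] :
    (topology A).IsZeroDimensional := by
  refine ⟨Set.range hat, ?_, ?_, fun o ho => ho⟩
  · rintro _ ⟨a, rfl⟩
    exact hat_mem_clopens a
  · rintro _ ⟨a, rfl⟩
    exact hat_mem_specOpens a

theorem isStone_topology (A : Type*) [MVAlgebra A] : (topology A).IsStone :=
  ⟨isCompact_topology A, isHausdorff_topology A, isZeroDimensional_topology A⟩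

/-- The homomorphism `a ↦ â` from `A` to `Clop (Max A)`. -/
noncomputable def hatClop (A : Type*) [MVAlgebra A] : MVHom A (topology A).Clop where
  toFun a := ⟨hat a, hat_mem_clopens a⟩
  map_zero' := MVTopology.Clop.ext hat_zero
  map_oplus' x y := MVTopology.Clop.ext (hat_oplus x y)
  map_star' x := MVTopology.Clop.ext (hat_star x)

end MaxSpec

/-! ### Semisimplicity and the pointwise form of limit cuts. -/

namespace MVAlgebra

open MaxSpec

/-- This makes `{0}` a point of the spectrum; evaluation at that point embeds a simple algebra into
`[0, 1]`. -/
theorem IsSimple.isMaximal_ker_id {B : Type*} [MVAlgebra B] (hB : IsSimple B) :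
    (MVIdeal.ker (MVHom.id B)).IsMaximal := by
  refine ⟨(hB _).2 rfl, fun J hJ _ => ?_⟩
  rw [(hB J).1 hJ]
  rfl

/-- The zero ideal of a simple factor pulls back along the projection to a maximal ideal of `A`. The
value of `â` at this ideal determines the coordinate of `a` in the factor, and the coordinates
determine `a`. -/
theorem IsSemisimple.hat_injective {A : Type u} [MVAlgebra A] (h : IsSemisimple A) :
    Function.Injective (hat (A := A)) := by
  obtain ⟨J, B, _, f, hB, hf, -⟩ := h
  intro a b hab
  apply hf
  funext j
  let p : MVHom A (B j) := ⟨fun a => f a j, congrFun f.map_zero j,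
    fun x y => congrFun (f.map_oplus x y) j, fun x => congrFun (f.map_star x) j⟩
  let M : MaxSpec (B j) := ⟨_, (hB j).isMaximal_ker_id⟩
  have h1 : hat (p a) M = hat (p b) M := by
    rw [← hat_comp_comap, ← hat_comp_comap, hab]
  -- As `M` is the zero ideal, membership of the distance in it says that the distance is `0`.
  have h2 := M.ideal.cls_eq_iff.1 (M.iota_injective h1)
  rw [MVIdeal.mvdist_mem_iff] at h2
  exact le_antisymm (ominus_eq_zero_iff.1 h2.1) (ominus_eq_zero_iff.1 h2.2)

/-- A proper ideal of `A / M` pulls back to a proper ideal containing `M`, hence equal to `M`, so it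
is zero. Conversely `{0}` is proper because `0 ≠ 1` in `A / M`. -/
theorem isSimple_quot {A : Type*} [MVAlgebra A] {M : MVIdeal A} (hM : M.IsMaximal) :
    IsSimple M.Quot := by
  intro I
  have hMI : M.carrier ⊆ (MVIdeal.comap M.proj I).carrier := by
    intro a ha
    change M.proj a ∈ I
    rw [M.proj_eq_zero_iff.2 ha]
    exact I.zero_mem
  constructor
  · intro hI
    have hp : (MVIdeal.comap M.proj I).IsProper := by
      rw [MVIdeal.isProper_iff] at hI ⊢
      intro h
      apply hI
      rw [← M.proj.map_one]
      exact h
    refine Set.Subset.antisymm ?_ (Set.singleton_subset_iff.2 I.zero_mem)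
    intro x hx
    obtain ⟨a, rfl⟩ := M.proj_surjective x
    apply M.proj_eq_zero_iff.2
    change a ∈ M.carrier
    rw [← hM.2 _ hp hMI]
    exact hx
  · intro hI
    rw [MVIdeal.isProper_iff]
    intro h
    have h0 : (1 : M.Quot) ∈ I.carrier := h
    rw [hI] at h0
    exact hM.isSimpleMVChain.zero_ne_one h0.symm

/-- The quotients `A / M` are the simple factors; equal classes modulo every `M` give equal hats. -/
theorem isSemisimple_of_hat_injective {A : Type u} [MVAlgebra A]
    (h : Function.Injective (hat (A := A))) : IsSemisimple A := by
  refine ⟨MaxSpec A, fun M => M.ideal.Quot, fun M => inferInstance,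
    ⟨fun a M => M.ideal.proj a, rfl, fun _ _ => rfl, fun _ => rfl⟩,
    fun M => isSimple_quot M.isMaximal, fun a b hab => h ?_, fun M => M.ideal.proj_surjective⟩
  exact funext fun M => congrArg M.iota (congrFun hab M)

/-- A cut is a limit cut iff, at every maximal ideal, its elements and its upper bounds come
arbitrarily close. -/
theorem isLimitCut_iff_forall {A : Type*} [MVAlgebra A] {S : Set A} :
    IsLimitCut S ↔ IsCut S ∧ ∀ (M : MaxSpec A) (ε : ℝ), 0 < ε →
      ∃ a ∈ S, ∃ b ∈ upper S, (hat b M : ℝ) - hat a M < ε := by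
  -- An element of `S` lies below every upper bound, so the distance is an ordinary difference at
  -- each point.
  have hd : ∀ {a b : A}, a ∈ S → b ∈ upper S → ∀ M,
      ((mvdist (hat a) (hat b) M : unitInterval) : ℝ) = (hat b M : ℝ) - hat a M :=
    fun ha hb M => unit_val_mvdist_of_le (hat_le_hat (hb _ ha) M)
  refine and_congr_right fun _ => ⟨fun h M ε hε => ?_, fun h => ?_⟩
  · by_contra! hcon
    -- If all differences at `M` were at least `ε`, the infimum there would be too; truncating at
    -- `1` keeps the bound inside the unit interval.
    have h1 : (⟨min ε 1, le_min hε.le zero_le_one, min_le_right _ _⟩ : unitInterval) ≤ 0 := by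
      have h2 := congrFun h M
      rw [sInf_apply] at h2
      change _ = (0 : unitInterval) at h2
      rw [← h2]
      refine le_iInf ?_
      rintro ⟨_, a, ha, b, hb, rfl⟩
      change min ε 1 ≤ ((mvdist (hat a) (hat b) M : unitInterval) : ℝ)
      rw [hd ha hb]
      exact (min_le_left _ _).trans (hcon a ha b hb)
    have h3 : min ε 1 ≤ 0 := h1
    exact absurd h3 (not_le.2 (lt_min hε one_pos))
  · funext M
    refine _root_.le_antisymm ?_ (unitInterval.nonneg' (t := _))
    change ((sInf _ : MaxSpec A → unitInterval) M : ℝ) ≤ 0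
    apply le_of_forall_pos_le_add
    intro ε hε
    obtain ⟨a, ha, b, hb, hab⟩ := h M ε hε
    have h0 : sInf {δ : MaxSpec A → unitInterval | ∃ a ∈ S, ∃ b ∈ upper S,
        δ = mvdist (hat a) (hat b)} ≤ mvdist (hat a) (hat b) := sInf_le ⟨a, ha, b, hb, rfl⟩
    have h1 : ((sInf {δ : MaxSpec A → unitInterval | ∃ a ∈ S, ∃ b ∈ upper S,
        δ = mvdist (hat a) (hat b)} M : unitInterval) : ℝ) ≤
        (mvdist (hat a) (hat b) M : unitInterval) := h0 M
    rw [hd ha hb] at h1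
    linarith

end MVAlgebra

/-! ### Clopen fuzzy sets on the spectrum of an lcc algebra. -/

namespace MaxSpec

theorem hatClop_bijective {A : Type u} [MVAlgebra A] (hA : IsLimitCutComplete A) :
    Function.Bijective (hatClop A) := by
  have hinj := hA.1.hat_injective
  refine ⟨fun a b h => hinj (congrArg MVTopology.Clop.val h), ?_⟩
  rintro ⟨o, ho, hoc⟩
  have ho' : o ∈ specOpens A := ho
  have hc' : ∼o ∈ specOpens A := (topology A).mem_closeds_iff.1 hoc
  rw [mem_specOpens_iff] at ho' hc'
  -- Openness of `o*`, read through complements: `o` is approximated from above by hats, as openness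
  -- of `o` approximates it from below.
  have hlow : ∀ M, ∀ ε : ℝ, 0 < ε → ∃ b : A, o ≤ hat b ∧ (hat b M : ℝ) < o M + ε := by
    intro M ε hε
    obtain ⟨b, hb, h1⟩ := hc' M ε hε
    refine ⟨∼b, ?_, ?_⟩
    · rw [hat_star]
      exact fuzzy_star_le_comm hb
    · rw [hat_star]
      have h2 : ((∼o) M : ℝ) = 1 - o M := rfl
      change 1 - (hat b M : ℝ) < _
      linarith
  let S : Set A := {a | hat a ≤ o}
  -- Because `o` is the join of the hats of `S`, bounding `S` amounts to bounding `o`.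
  have hub : ∀ b, b ∈ upper S ↔ o ≤ hat b := by
    intro b
    refine ⟨fun hb M => ?_, fun hb a ha => le_of_hat_le hinj (ha.trans hb)⟩
    change (o M : ℝ) ≤ hat b M
    apply le_of_forall_pos_le_add
    intro ε hε
    obtain ⟨a, ha, h1⟩ := ho' M ε hε
    have h2 : (hat a M : ℝ) ≤ hat b M := hat_le_hat (hb a ha) M
    linarith
  -- Dually, `o` is the meet of the hats above it. This gives `l u S ⊆ S`, and later bounds the hat
  -- of the supremum from above.
  have hle : ∀ a, (∀ b ∈ upper S, a ≤ₘ b) → hat a ≤ o := by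
    intro a ha M
    change (hat a M : ℝ) ≤ o M
    apply le_of_forall_pos_le_add
    intro ε hε
    obtain ⟨b, hb, h1⟩ := hlow M ε hε
    have h2 : (hat a M : ℝ) ≤ hat b M := hat_le_hat (ha b ((hub b).2 hb)) M
    linarith
  have hcut : IsLimitCut S := by
    rw [isLimitCut_iff_forall]
    refine ⟨Set.Subset.antisymm (fun a ha b hb => hb a ha) hle, fun M ε hε => ?_⟩
    -- Both approximations to `o M` are within `ε / 2`, so they are within `ε` of each other.
    obtain ⟨a, ha, h1⟩ := ho' M (ε / 2) (half_pos hε)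
    obtain ⟨b, hb, h2⟩ := hlow M (ε / 2) (half_pos hε)
    exact ⟨a, ha, b, (hub b).2 hb, by linarith⟩
  obtain ⟨s, hs, hmin⟩ := hA.2 S hcut
  exact ⟨s, MVTopology.Clop.ext (_root_.le_antisymm (hle s hmin) ((hub s).1 hs))⟩

end MaxSpec

/-! ### Algebras of clopen fuzzy sets and their points. -/

namespace MVTopology

open MaxSpec

variable {X Y : Type*}

/-- The evaluation of clopen fuzzy sets at a point. -/
noncomputable def evalAt (Ω : MVTopology X) (x : X) : MVHom Ω.Clop unitInterval :=
  ⟨fun c => c.val x, rfl, fun _ _ => rfl, fun _ => rfl⟩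

/-- The maximal ideal of the clopen fuzzy sets that vanish at a point. -/
noncomputable def toMaxSpec (Ω : MVTopology X) (x : X) : MaxSpec Ω.Clop :=
  ⟨MVIdeal.ker (Ω.evalAt x), ker_isMaximal _⟩

/-- The abstract evaluation at the ideal and the concrete evaluation at `x` have the same kernel,
and a homomorphism into `[0, 1]` is determined by its kernel. -/
theorem hat_toMaxSpec (Ω : MVTopology X) (x : X) (c : Ω.Clop) :
    hat c (Ω.toMaxSpec x) = c.val x := by
  have h : (Ω.toMaxSpec x).eval = Ω.evalAt x :=
    MVHom.eq_of_ker_eq fun _ => eval_eq_zero_iff _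
  exact congrArg (fun f : MVHom Ω.Clop unitInterval => f c) h

theorem hat_injective (Ω : MVTopology X) : Function.Injective (hat (A := Ω.Clop)) := by
  intro a b h
  ext1
  funext x
  rw [← hat_toMaxSpec, h, hat_toMaxSpec]

theorem clop_le_iff {Ω : MVTopology X} {a b : Ω.Clop} : a ≤ₘ b ↔ a.val ≤ b.val := by
  rw [← fuzzy_le_iff]
  exact ⟨congrArg Clop.val, fun h => Clop.ext h⟩

/-- Read at the ideals of the points, the limit condition says that the join of `S` coincides
pointwise with the meet of its upper bounds. The join is open and the meet is closed, so this fuzzy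
set is clopen and serves as supremum. -/
theorem isLimitCutComplete_clop {X : Type u} (Ω : MVTopology X) :
    IsLimitCutComplete Ω.Clop := by
  refine ⟨isSemisimple_of_hat_injective Ω.hat_injective, fun S hS => ?_⟩
  rw [isLimitCut_iff_forall] at hS
  let o : X → unitInterval := sSup (Clop.val '' S)
  have hlow : ∀ b ∈ upper S, o ≤ b.val := by
    intro b hb
    apply sSup_le
    rintro _ ⟨a, ha, rfl⟩
    exact clop_le_iff.1 (hb a ha)
  -- The join of `S` is the meet of its upper bounds, written with complements because openness is
  -- stable under joins.
  have hco : ∼o = sSup ((fun b : Ω.Clop => ∼b.val) '' upper S) := by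
    apply _root_.le_antisymm
    · intro x
      change 1 - (o x : ℝ) ≤ (sSup ((fun b : Ω.Clop => ∼b.val) '' upper S) x : unitInterval)
      apply le_of_forall_pos_le_add
      intro ε hε
      obtain ⟨a, ha, b, hb, h⟩ := hS.2 (Ω.toMaxSpec x) ε hε
      rw [hat_toMaxSpec, hat_toMaxSpec] at h
      have h1 : (a.val x : ℝ) ≤ o x :=
        le_sSup (α := X → unitInterval) (Set.mem_image_of_mem Clop.val ha) x
      have h2 : 1 - (b.val x : ℝ) ≤
          (sSup ((fun b : Ω.Clop => ∼b.val) '' upper S) x : unitInterval) :=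
        le_sSup (α := X → unitInterval)
          (Set.mem_image_of_mem (fun b : Ω.Clop => ∼b.val) hb) x
      linarith
    · apply sSup_le
      rintro _ ⟨b, hb, rfl⟩
      exact fuzzy_le_iff.1 (star_le_star (fuzzy_le_iff.2 (hlow b hb)))
  have ho : o ∈ Ω.clopens := by
    refine ⟨Ω.sSup_mem _ ?_, Ω.mem_closeds_iff.2 ?_⟩
    · rintro _ ⟨a, -, rfl⟩
      exact a.property.1
    · rw [hco]
      refine Ω.sSup_mem _ ?_
      rintro _ ⟨b, -, rfl⟩
      exact Ω.mem_closeds_iff.1 b.property.2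
  exact ⟨⟨o, ho⟩, fun a ha => clop_le_iff.2 (le_sSup (Set.mem_image_of_mem _ ha)),
    fun b hb => clop_le_iff.2 (hlow b hb)⟩

/-! ### A Stone MV-space as the spectrum of its clopens. -/

theorem IsZeroDimensional.exists_eq_sSup {Ω : MVTopology X} (h : Ω.IsZeroDimensional)
    {o : X → unitInterval} (ho : o ∈ Ω.opens) : ∃ G ⊆ Ω.clopens, o = sSup G := by
  obtain ⟨Θ, hΘ, -, h1⟩ := h
  obtain ⟨G, hG, rfl⟩ := h1 o ho
  exact ⟨G, hG.trans hΘ, rfl⟩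

/-- Injectivity: an open set with value `1` at `x` and `0` at `y` contains a clopen positive at `x`,
so clopens separate points. Surjectivity: a maximal ideal without common zero would cover the space,
and compactness would put `1` into it. -/
theorem IsStone.toMaxSpec_bijective {Ω : MVTopology X} (h : Ω.IsStone) :
    Function.Bijective Ω.toMaxSpec := by
  constructor
  · intro x y hxy
    by_contra hne
    obtain ⟨o, ho, o', -, hx, hy, hinf⟩ := h.2.1 x y hne
    obtain ⟨G, hG, rfl⟩ := h.2.2.exists_eq_sSup ho
    have h1 : (0 : ℝ) < (sSup G x : unitInterval) := by
      rw [hx]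
      exact one_pos
    obtain ⟨c, hc, h2⟩ := exists_lt_of_sSup _root_.le_rfl h1
    -- Points with the same ideal give every clopen the same value.
    have h3 : c x = c y := by
      have := congrArg (hat (⟨c, hG hc⟩ : Ω.Clop)) hxy
      rwa [hat_toMaxSpec, hat_toMaxSpec] at this
    have h4 : sSup G y = 0 := by
      have : sSup G y ⊓ o' y = 0 := congrFun hinf y
      rw [hy] at this
      have e : sSup G y ⊓ 1 = sSup G y := inf_eq_left.2 (unitInterval.le_one' (t := _))
      rwa [e] at this
    have h5 : (c y : ℝ) ≤ (sSup G y : unitInterval) := le_sSup hc y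
    rw [h4, ← h3] at h5
    exact absurd h2 (not_lt.2 h5)
  · intro M
    -- By maximality it is enough that `M` is contained in the ideal of a point.
    suffices hx : ∃ x, ∀ c ∈ M.ideal, c.val x = 0 by
      obtain ⟨x, hx⟩ := hx
      exact ⟨x, MaxSpec.ext (M.isMaximal.eq_of_le (Ω.toMaxSpec x).isMaximal.1 hx).symm⟩
    by_contra! hcon
    -- A member of `M` that is merely positive at `x` has a multiple equal to `1` there, and
    -- multiples remain in `M`.
    have hsup : sSup (Clop.val '' M.ideal.carrier) = 1 := by
      funext x
      obtain ⟨c, hc, hcx⟩ := hcon x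
      obtain ⟨n, hn⟩ := unit_exists_nmul hcx
      refine _root_.le_antisymm (unitInterval.le_one' (t := _)) ?_
      have h1 : (nmul n c).val ≤ sSup (Clop.val '' M.ideal.carrier) :=
        le_sSup (Set.mem_image_of_mem _ (M.ideal.nmul_mem hc n))
      have h2 : (nmul n c).val x = 1 := ((Ω.evalAt x).map_nmul n c).trans hn
      have h3 := h1 x
      rwa [h2] at h3
    obtain ⟨l, hl, hsum⟩ := h.1 _ (by
      rintro _ ⟨c, -, rfl⟩
      exact c.property.1) hsup
    -- The sum of the additive covering is again in `M`, contradicting properness.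
    have key : ∀ l : List (X → unitInterval), (∀ o ∈ l, o ∈ Clop.val '' M.ideal.carrier) →
        ∃ c ∈ M.ideal, c.val = sumList l := by
      intro l
      induction l with
      | nil => exact fun _ => ⟨0, M.ideal.zero_mem, rfl⟩
      | cons o l ih =>
        intro h
        obtain ⟨c, hc, hcl⟩ := ih fun p hp => h p (List.mem_cons_of_mem _ hp)
        obtain ⟨d, hd, rfl⟩ := h o List.mem_cons_self
        refine ⟨d ⊕ₘ c, M.ideal.oplus_mem hd hc, ?_⟩
        change d.val ⊕ₘ c.val = d.val ⊕ₘ sumList l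
        rw [hcl]
    obtain ⟨c, hc, hcl⟩ := key l hl
    have hc1 : c = 1 := Clop.ext (hcl.trans hsum)
    exact M.ideal.isProper_iff.1 M.isMaximal.1 (hc1 ▸ hc)

theorem hat_comp_toMaxSpec (Ω : MVTopology X) (c : Ω.Clop) : hat c ∘ Ω.toMaxSpec = c.val :=
  funext fun x => Ω.hat_toMaxSpec x c

/-- Joins are pointwise, so continuity need only be tested on a base. -/
theorem sSup_comp (G : Set (Y → unitInterval)) (f : X → Y) :
    sSup G ∘ f = sSup ((fun o => o ∘ f) '' G) := by
  funext x
  rw [Function.comp_apply, sSup_apply_eq_sSup_image, sSup_apply_eq_sSup_image, Set.image_image]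
  rfl

theorem continuous_toMaxSpec (Ω : MVTopology X) :
    Continuous Ω (topology Ω.Clop) Ω.toMaxSpec := by
  rintro _ ⟨G, hG, rfl⟩
  rw [sSup_comp]
  refine Ω.sSup_mem _ ?_
  rintro _ ⟨o, ho, rfl⟩
  obtain ⟨c, rfl⟩ := hG ho
  change hat c ∘ Ω.toMaxSpec ∈ Ω.opens
  rw [hat_comp_toMaxSpec]
  exact c.property.1

/-- A Stone MV-space is in bijection with the maximal spectrum of its clopen algebra. -/
noncomputable def IsStone.equivMaxSpec {Ω : MVTopology X} (h : Ω.IsStone) :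
    X ≃ MaxSpec Ω.Clop := Equiv.ofBijective Ω.toMaxSpec h.toMaxSpec_bijective

/-- The bijection transports each clopen `c` to `ĉ`; these are bases of the two topologies. -/
theorem IsStone.isHomeo_equivMaxSpec {Ω : MVTopology X} (h : Ω.IsStone) :
    IsHomeo Ω (topology Ω.Clop) h.equivMaxSpec := by
  refine ⟨Ω.continuous_toMaxSpec, fun o ho => ?_⟩
  obtain ⟨G, hG, rfl⟩ := h.2.2.exists_eq_sSup ho
  rw [sSup_comp]
  refine (topology Ω.Clop).sSup_mem _ ?_
  rintro _ ⟨c, hc, rfl⟩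
  have e : c ∘ h.equivMaxSpec.symm = hat (⟨c, hG hc⟩ : Ω.Clop) := by
    rw [Equiv.comp_symm_eq]
    exact (hat_comp_toMaxSpec Ω ⟨c, hG hc⟩).symm
  change c ∘ h.equivMaxSpec.symm ∈ specOpens _
  rw [e]
  exact hat_mem_specOpens _

end MVTopology

/-! ### The categorical duality. -/

open MaxSpec MVTopology

/-- A bijective homomorphism is an isomorphism in the category of MV-algebras. -/
noncomputable def MVAlg.isoOfBijective {A B : MVAlg.{u}} (f : MVHom A.carrier B.carrier)
    (hf : Function.Bijective f) : A ≅ B where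
  hom := f
  inv :=
    { toFun := (Equiv.ofBijective f hf).symm
      map_zero' := by
        rw [Equiv.symm_apply_eq]
        exact f.map_zero.symm
      map_oplus' := fun x y => by
        rw [Equiv.symm_apply_eq]
        refine Eq.trans ?_ (f.map_oplus _ _).symm
        exact (congrArg₂ oplus (Equiv.ofBijective_apply_symm_apply f hf x)
          (Equiv.ofBijective_apply_symm_apply f hf y)).symm
      map_star' := fun x => by
        rw [Equiv.symm_apply_eq]
        refine Eq.trans ?_ (f.map_star _).symm
        exact (congrArg MVAlgebra.star (Equiv.ofBijective_apply_symm_apply f hf x)).symm }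
  hom_inv_id := MVHom.ext (funext fun x => Equiv.ofBijective_symm_apply_apply f hf x)
  inv_hom_id := MVHom.ext (funext fun x => Equiv.ofBijective_apply_symm_apply f hf x)

/-- An MV-homeomorphism is an isomorphism in the category of MV-topological spaces. -/
def MVTop.isoOfHomeo {σ τ : MVTop.{u}} (e : σ.carrier ≃ τ.carrier)
    (he : IsHomeo σ.topology τ.topology e) : σ ≅ τ where
  hom := ⟨e, he.1⟩
  inv := ⟨e.symm, he.2⟩
  hom_inv_id := Subtype.ext (funext e.symm_apply_apply)
  inv_hom_id := Subtype.ext (funext e.apply_symm_apply)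

theorem isStoneMV_maxFunctor (A : LccMVAlg.{u}) :
    isStoneMV (maxFunctor.obj (Opposite.op A.obj)) := isStone_topology _

theorem isLcc_clopFunctor (τ : StoneMVTop.{u}) :
    isLcc (clopFunctor.obj (Opposite.op τ.obj)) := isLimitCutComplete_clop _

/-- The restriction of `Max` to limit cut complete algebras and Stone MV-spaces. -/
noncomputable def maxRestricted : LccMVAlg.{u}ᵒᵖ ⥤ StoneMVTop.{u} :=
  isStoneMV.lift (isLcc.ι.op ⋙ maxFunctor) fun A => isStoneMV_maxFunctor A.unop

/-- The restriction of `Clop` to Stone MV-spaces and limit cut complete algebras. -/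
noncomputable def clopRestricted : StoneMVTop.{u}ᵒᵖ ⥤ LccMVAlg.{u} :=
  isLcc.lift (isStoneMV.ι.op ⋙ clopFunctor) fun τ => isLcc_clopFunctor τ.unop

/-- The natural isomorphism `a ↦ â` between a limit cut complete algebra and the clopen algebra of
its maximal spectrum. -/
noncomputable def hatNatIso : maxRestricted ⋙ clopRestricted.rightOp ≅ 𝟭 LccMVAlg.{u}ᵒᵖ :=
  NatIso.ofComponents
    -- Passing to the opposite category reverses `a ↦ â`, so the component runs from the clopen
    -- algebra of the spectrum to `A`.
    (fun A => (isLcc.isoMk (X := A.unop)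
      (Y := clopRestricted.obj (Opposite.op (maxRestricted.obj A)))
      (MVAlg.isoOfBijective (hatClop A.unop.obj.carrier)
        (hatClop_bijective A.unop.property))).op)
    -- Naturality is the identity `b̂ ∘ Max f = hat (f b)`.
    (fun {A B} f => by
      apply Quiver.Hom.unop_inj
      ext
      exact MVHom.ext (funext fun b => Clop.ext (hat_comp_comap f.unop.hom b)))

/-- The natural isomorphism between a Stone MV-space and the maximal spectrum of its clopen
algebra. -/
noncomputable def maxSpecNatIso : 𝟭 StoneMVTop.{u} ≅ clopRestricted.rightOp ⋙ maxRestricted :=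
  NatIso.ofComponents
    (fun τ => isStoneMV.isoMk (X := τ)
      (Y := maxRestricted.obj (Opposite.op (clopRestricted.obj (Opposite.op τ))))
      (MVTop.isoOfHomeo τ.property.equivMaxSpec τ.property.isHomeo_equivMaxSpec))
    -- The preimage of `M_x` under `Clop f` consists of the `c` with `c (f x) = 0`, which is the
    -- ideal of `f x` by definition.
    (fun {σ τ} f => by
      ext
      apply Subtype.ext
      rfl)

/-- The duality between limit cut complete MV-algebras and Stone MV-spaces. -/
noncomputable def lccDuality : LccMVAlg.{u}ᵒᵖ ≌ StoneMVTop.{u} :=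
  -- This constructor adjusts the unit so that the triangle identity holds, and leaves the two
  -- functors unchanged; the main theorem identifies them by `rfl`.
  CategoryTheory.Equivalence.mk maxRestricted clopRestricted.rightOp hatNatIso.symm maxSpecNatIso.symm

theorem theorem4p9 :
    ∃ (hMax : ∀ A : LccMVAlg.{u}, isStoneMV (maxFunctor.obj (Opposite.op A.obj)))
      (hClop : ∀ τ : StoneMVTop.{u}, isLcc (clopFunctor.obj (Opposite.op τ.obj))),
      (∃ e : LccMVAlg.{u}ᵒᵖ ≌ StoneMVTop.{u},
        e.functor = isStoneMV.lift (isLcc.ι.op ⋙ maxFunctor) (fun A => hMax A.unop) ∧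
        e.inverse =
          (isLcc.lift (isStoneMV.ι.op ⋙ clopFunctor) (fun τ => hClop τ.unop)).rightOp) ∧
      (∀ A : Type u, ∀ [MVAlgebra A], MVAlgebra.IsLimitCutComplete A →
        ∃ f : MVHom A (MaxSpec.topology A).Clop, Function.Bijective f) ∧
      (∀ X : Type u, ∀ Ω : MVTopology X, Ω.IsStone →
        ∃ e : X ≃ MaxSpec Ω.Clop, MVTopology.IsHomeo Ω (MaxSpec.topology Ω.Clop) e) :=
  ⟨isStoneMV_maxFunctor, isLcc_clopFunctor, ⟨lccDuality, rfl, rfl⟩,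
    fun A _ hA => ⟨hatClop A, hatClop_bijective hA⟩,
    fun _ _ hΩ => ⟨hΩ.equivMaxSpec, hΩ.isHomeo_equivMaxSpec⟩⟩
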